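/- For positive definite $d\times d$ matrices $A,B$ let $D_{\mathrm F}(A\Vert B)=\|I-B^{-1/2}AB^{-1/2}\|_F$ and $D_{\mathrm{op}}(A\Vert B)=\|I-B^{-1/2}AB^{-1/2}\|_{\mathrm{op}}$ (Frobenius norm and Euclidean operator norm; the same formulas are used when $A$ is an arbitrary real matrix). For integers $n,d_1,d_2\ge 1$ and positive definite matrices $\Theta_1\in\mathrm{PD}(d_1)$, $\Theta_2\in\mathrm{PD}(d_2)$, let $X=(X_1,\dots,X_n)$ be $n$ independent samples of the matrix normal model with precision matrices $\Theta_1,\Theta_2$, i.e. of the centered Gaussian on $\mathbb R^{d_1}\otimes\mathbb R^{d_2}$ with covariance matrix $(\Theta_1\otimes\Theta_2)^{-1}=\Theta_1^{-1}\otimes\Theta_2^{-1}$. Let $B\subset\mathrm{PD}(d_1)$ be the (open) ball of radius $1/2$ about $I_{d_1}$ in the operator norm. Let $\mathcal S$ be either the set $B\times\mathrm{PD}(d_2)$, or its subset of the pairs $(\Theta_1,\Theta_2)$ that satisfy the identifiability convention $(\det\Theta_1)^{1/d_1}=(\det\Theta_2)^{1/d_2}$. There is a universal constant $c>0$ such that,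 for all $n,d_1,d_2\ge1$, both choices of $\mathcal S$ and every estimator $\widehat\Theta_1$ of $\Theta_1$ (a measurable function of $X$ with values in the $d_1\times d_1$ real matrices), the following holds. 1. If $\delta\ge0$ and $\delta^2=c\,\min\{1,\ d_1^2/(n\min\{nd_1,d_2\})\}$, then $$\sup_{(\Theta_1,\Theta_2)\in\mathcal S}\Pr\bigl[D_{\mathrm F}(\widehat\Theta_1(X)\Vert\Theta_1)\ge\delta\bigr]\ \ge\ \tfrac12 .$$ 2. If $\delta\ge0$ and $\delta^2=c\,\min\{1,\ d_1/(n\min\{nd_1,d_2\})\}$, then $$\sup_{(\Theta_1,\Theta_2)\in\mathcal S}\Pr\bigl[D_{\mathrm{op}}(\widehat\Theta_1(X)\Vert\Theta_1)\ge\delta\bigr]\ \ge\ \tfrac12 .$$ As a consequence, there is a universal constant $c'>0$ such that, for all such $n,d_1,d_2$, $\mathcal S$ and $\widehat\Theta_1$, $$\sup_{(\Theta_1,\Theta_2)\in\mathcal S}\mathbb E\bigl[D_{\mathrm F}(\widehat\Theta_1(X)\Vert\Theta_1)^2\bigr]\ \ge\ c'\min\Bigl\{1,\frac{d_1^2}{n\min\{nd_1,d_2\}}\Bigr\}$$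 and $$\sup_{(\Theta_1,\Theta_2)\in\mathcal S}\mathbb E\bigl[D_{\mathrm{op}}(\widehat\Theta_1(X)\Vert\Theta_1)^2\bigr]\ \ge\ c'\min\Bigl\{1,\frac{d_1}{n\min\{nd_1,d_2\}}\Bigr\},$$ where the expectations may be $+\infty$. -/

import Mathlib

open MeasureTheory ProbabilityTheory
open scoped ENNReal Kronecker MatrixOrder

noncomputable section

namespace MatrixNormal

/-- The Frobenius norm `(tr Mᵀ M)^(1/2)`. -/
def frobNorm {d : ℕ} (M : Matrix (Fin d) (Fin d) ℝ) : ℝ :=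
  Real.sqrt (Matrix.trace (M.transpose * M))

/-- The operator norm with respect to the Euclidean norm on `ℝ^d`. -/
def opNorm {d : ℕ} (M : Matrix (Fin d) (Fin d) ℝ) : ℝ :=
  ‖Matrix.toEuclideanCLM (𝕜 := ℝ) M‖

/-- `I - B^(-1/2) A B^(-1/2)`, where `B^(-1/2)` is the positive definite square root of `B⁻¹`
(used for positive definite `B`). -/
def relDiff {d : ℕ} (A B : Matrix (Fin d) (Fin d) ℝ) : Matrix (Fin d) (Fin d) ℝ :=
  1 - CFC.sqrt B⁻¹ * A * CFC.sqrt B⁻¹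

/-- The relative Frobenius error `D_F(A ‖ B)`. -/
def relFrob {d : ℕ} (A B : Matrix (Fin d) (Fin d) ℝ) : ℝ :=
  frobNorm (relDiff A B)

/-- The relative spectral error `D_op(A ‖ B)`. -/
def relOp {d : ℕ} (A B : Matrix (Fin d) (Fin d) ℝ) : ℝ :=
  opNorm (relDiff A B)

/-- The data space: tuples of `n` samples, each a `d₁ × d₂` array of reals. -/
abbrev Samples (n d₁ d₂ : ℕ) : Type :=
  Fin n → EuclideanSpace ℝ (Fin d₁ × Fin d₂)

/-- The law of `n` independent samples of the matrix normal model with precision matrices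
`Θ₁, Θ₂`: each is a centered Gaussian with covariance `(Θ₁ ⊗ Θ₂)⁻¹ = Θ₁⁻¹ ⊗ Θ₂⁻¹`. -/
def law (n : ℕ) {d₁ d₂ : ℕ} (Θ₁ : Matrix (Fin d₁) (Fin d₁) ℝ)
    (Θ₂ : Matrix (Fin d₂) (Fin d₂) ℝ) : Measure (Samples n d₁ d₂) :=
  Measure.pi fun _ : Fin n => multivariateGaussian 0 (Θ₁ ⊗ₖ Θ₂)⁻¹

/-- All pairs of positive definite matrices `(Θ₁, Θ₂)` with `Θ₁` in the ball of radius `1/2`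
about the identity in the operator norm. -/
def params (d₁ d₂ : ℕ) : Set (Matrix (Fin d₁) (Fin d₁) ℝ × Matrix (Fin d₂) (Fin d₂) ℝ) :=
  {θ | θ.1.PosDef ∧ opNorm (θ.1 - 1) < 1 / 2 ∧ θ.2.PosDef}

/-- The pairs in `params d₁ d₂` that obey the convention which makes the Kronecker factors
identifiable from `Θ₁ ⊗ Θ₂`, namely `(det Θ₁)^(1/d₁) = (det Θ₂)^(1/d₂)`. -/
def normalizedParams (d₁ d₂ : ℕ) :
    Set (Matrix (Fin d₁) (Fin d₁) ℝ × Matrix (Fin d₂) (Fin d₂) ℝ) :=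
  {θ ∈ params d₁ d₂ | θ.1.det ^ (1 / (d₁ : ℝ)) = θ.2.det ^ (1 / (d₂ : ℝ))}

/-- An estimator of `Θ₁`: a (Borel) measurable matrix-valued function of the data. -/
def IsEstimator {n d₁ d₂ : ℕ} (est : Samples n d₁ d₂ → Matrix (Fin d₁) (Fin d₁) ℝ) : Prop :=
  ∀ i j, Measurable fun x => est x i j

end MatrixNormal

end

/-! The lower bounds come from testing among finitely many precision matrices.

*Testing.* For laws `P k` and a common reference law `Q` such that `(∫ f dP k)² ≤ K ∫ f² dQ` for all
`f` (`SqDom`), a test with disjoint acceptance regions accepts some `k` with `P k`-probability at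
most `√(K / M)`, where `M` is the number of hypotheses. Hence it suffices that `K` is a small
multiple of `M`, and no logarithms as in Fano's inequality occur. The constants of
`SqDom` multiply over independent coordinates (`SqDom.pi`).

*Row factor.* For `2 ≤ d₁` the precision matrices are `(1 - V)ᵀ (1 - V)`, where `V` is supported on
the upper right block of size `p × (d₁ - p)`, with `p` half of `d₁` for the Frobenius norm and
`p = 1` for the operator norm. They have determinant one, so the identifiability convention only
asks for column factors of determinant one, and on the upper right block they are affine in `V`.
One column of data is a Gaussian vector sheared by `1 + V`; its domination constant is at most
`exp (2 ‖V‖²)` with the Frobenius norm, whatever the dimension (`sqDom_stdPi_shear`,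
`lintegral_exp_mulVec_sq_le`). A ball of radius `r` in the space of blocks contains `128 ^ dim`
points at distance `r / 128` (`exists_separated_finset`), whereas `K` is at most `2 ^ dim`
as long as `r²` times the number of columns is at most a small multiple of the dimension. For
`d₁ = 1` a family of 128 scalars is used instead.

*Column factor.* If `d₂ ≤ n d₁`, there are `n d₂` columns and nothing else is needed. If
`n d₁ < d₂`, put `m = n d₁` and give the column factor a prior: its covariance is `L Lᵀ` with `L`
unipotent, where the lower left block of `L` is a Gaussian matrix `H` of scale `R`. The first `m`
columns of the data are then free noise, and every further column is a combination, with coefficients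
from `H`, of the first `m` columns plus a noise column. Stacked over the samples, the first `m`
columns form a square matrix, which is almost surely invertible, so the noise column is itself a
combination of them and amounts to a shift of `H`, which is imperceptible as `R → ∞`
(`eventually_sq_hitProb_le`). In the limit the data are a randomized function of the first `m`
columns of each sample only, so the effective number of columns is `n min (n d₁, d₂)`
(`exists_law_le`).

The bounds for the mean squared error follow by Markov's inequality. -/

open MeasureTheory ProbabilityTheory
open scoped ENNReal Kronecker MatrixOrder

namespace MatrixNormal

/-! ### Domination in mean square -/

theorem sq_lintegral_mul_le {α : Type*} [MeasurableSpace α] (μ : Measure α) {f g : α → ℝ≥0∞}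
    (hf : AEMeasurable f μ) (hg : AEMeasurable g μ) :
    (∫⁻ x, f x * g x ∂μ) ^ 2 ≤ (∫⁻ x, f x ^ 2 ∂μ) * ∫⁻ x, g x ^ 2 ∂μ := by
  have h := ENNReal.lintegral_mul_le_Lp_mul_Lq μ Real.HolderConjugate.two_two hf hg
  calc (∫⁻ x, f x * g x ∂μ) ^ 2
      ≤ ((∫⁻ a, f a ^ (2 : ℝ) ∂μ) ^ (1 / 2 : ℝ) * (∫⁻ a, g a ^ (2 : ℝ) ∂μ) ^ (1 / 2 : ℝ)) ^ 2 := by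
        gcongr
        exact h
    _ = (∫⁻ x, f x ^ 2 ∂μ) * ∫⁻ x, g x ^ 2 ∂μ := by
        rw [mul_pow, ← ENNReal.rpow_natCast, ← ENNReal.rpow_natCast, ← ENNReal.rpow_mul,
          ← ENNReal.rpow_mul]
        norm_num

/-- `P` is dominated by `Q` with constant `K` in the `L²` sense. For probability measures this says
that `P` has a density with respect to `Q` whose second moment (one plus the `χ²` divergence) is at
most `K`; the formulation by test functions avoids densities. -/
def SqDom {α : Type*} [MeasurableSpace α] (P Q : Measure α) (K : ℝ≥0∞) : Prop :=
  ∀ f : α → ℝ≥0∞, Measurable f → (∫⁻ x, f x ∂P) ^ 2 ≤ K * ∫⁻ x, f x ^ 2 ∂Q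

namespace SqDom

variable {α : Type*} [MeasurableSpace α]

theorem mono {P Q : Measure α} {K K' : ℝ≥0∞} (h : SqDom P Q K) (hK : K ≤ K') : SqDom P Q K' :=
  fun f hf => (h f hf).trans (by gcongr)

theorem withDensity (Q : Measure α) {L : α → ℝ≥0∞} (hL : Measurable L) :
    SqDom (Q.withDensity L) Q (∫⁻ x, L x ^ 2 ∂Q) := by
  intro f hf
  rw [lintegral_withDensity_eq_lintegral_mul _ hL hf]
  exact sq_lintegral_mul_le Q hL.aemeasurable hf.aemeasurable

theorem refl (P : Measure α) [IsProbabilityMeasure P] : SqDom P P 1 := by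
  have h := withDensity P (L := 1) measurable_const
  simpa using h

/-- The domination constants multiply over independent coordinates. -/
theorem pi {ι : Type*} [Fintype ι] {X : ι → Type*} [∀ i, MeasurableSpace (X i)]
    {P Q : ∀ i, Measure (X i)} [∀ i, SigmaFinite (P i)] [∀ i, SigmaFinite (Q i)]
    {K : ι → ℝ≥0∞} (h : ∀ i, SqDom (P i) (Q i) (K i)) :
    SqDom (Measure.pi P) (Measure.pi Q) (∏ i, K i) := by
  classical
  intro f hf
  rcases isEmpty_or_nonempty (∀ i, X i) with he | ⟨⟨x₀⟩⟩
  · simp [lintegral_of_isEmpty]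
  have key : ∀ (s : Finset ι) (x : ∀ i, X i),
      ((∫⋯∫⁻_s, f ∂P) x) ^ 2 ≤ (∏ i ∈ s, K i) * (∫⋯∫⁻_s, (fun y => f y ^ 2) ∂Q) x := by
    intro s
    induction s using Finset.induction_on with
    | empty => intro x; simp
    | insert i s hi ih =>
      intro x
      rw [lmarginal_insert f hf hi, lmarginal_insert _ (hf.pow_const 2) hi,
        Finset.prod_insert hi]
      calc (∫⁻ xi, (∫⋯∫⁻_s, f ∂P) (Function.update x i xi) ∂P i) ^ 2
          ≤ K i * ∫⁻ xi, ((∫⋯∫⁻_s, f ∂P) (Function.update x i xi)) ^ 2 ∂Q i :=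
            h i _ ((hf.lmarginal P).comp (measurable_update x))
        _ ≤ K i * ∫⁻ xi, (∏ j ∈ s, K j) *
              (∫⋯∫⁻_s, (fun y => f y ^ 2) ∂Q) (Function.update x i xi) ∂Q i := by
            gcongr with xi
            exact ih _
        _ = _ := by
            rw [lintegral_const_mul, mul_assoc]
            exact ((hf.pow_const 2).lmarginal Q).comp (measurable_update x)
  have := key Finset.univ x₀
  rwa [← lintegral_eq_lmarginal_univ, ← lintegral_eq_lmarginal_univ] at this

end SqDom

/-! ### Gaussian computations on the line -/

theorem gaussianReal_eq_withDensity_shift (a : ℝ) :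
    gaussianReal a 1 = (gaussianReal 0 1).withDensity
      (fun x => ENNReal.ofReal (Real.exp (a * x - a ^ 2 / 2))) := by
  rw [gaussianReal_of_var_ne_zero _ one_ne_zero, gaussianReal_of_var_ne_zero _ one_ne_zero,
    ← withDensity_mul _ (measurable_gaussianPDF 0 1) (by fun_prop)]
  congr 1
  ext x
  simp only [gaussianPDF, Pi.mul_apply, gaussianPDFReal]
  rw [← ENNReal.ofReal_mul (by positivity), mul_assoc _ (Real.exp _), ← Real.exp_add]
  congr 3
  simp
  ring

theorem lintegral_exp_mul_gaussianReal (t : ℝ) :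
    ∫⁻ x, ENNReal.ofReal (Real.exp (t * x)) ∂(gaussianReal 0 1)
      = ENNReal.ofReal (Real.exp (t ^ 2 / 2)) := by
  rw [← ofReal_integral_eq_lintegral_ofReal (integrable_exp_mul_gaussianReal t)
    (Filter.Eventually.of_forall fun x => (Real.exp_pos _).le)]
  have := congrFun (mgf_id_gaussianReal (μ := 0) (v := 1)) t
  simp only [mgf, id] at this
  rw [this]
  simp

theorem sqDom_gaussianReal_shift (a : ℝ) :
    SqDom (gaussianReal a 1) (gaussianReal 0 1) (ENNReal.ofReal (Real.exp (a ^ 2))) := by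
  rw [gaussianReal_eq_withDensity_shift a]
  refine (SqDom.withDensity _ (by fun_prop)).mono (le_of_eq ?_)
  have : ∀ x : ℝ, ENNReal.ofReal (Real.exp (a * x - a ^ 2 / 2)) ^ 2
      = ENNReal.ofReal (Real.exp (- a ^ 2)) * ENNReal.ofReal (Real.exp (2 * a * x)) := by
    intro x
    rw [← ENNReal.ofReal_pow (Real.exp_pos _).le, ← ENNReal.ofReal_mul (Real.exp_pos _).le,
      ← Real.exp_nat_mul, ← Real.exp_add]
    congr 2
    push_cast
    ring
  simp_rw [this]
  rw [lintegral_const_mul _ (by fun_prop), lintegral_exp_mul_gaussianReal,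
    ← ENNReal.ofReal_mul (Real.exp_pos _).le, ← Real.exp_add]
  congr 2
  ring

theorem lintegral_exp_sq_gaussianReal {s : ℝ} (hs : s < 1 / 2) :
    ∫⁻ x, ENNReal.ofReal (Real.exp (s * x ^ 2)) ∂(gaussianReal 0 1)
      = ENNReal.ofReal (√(1 - 2 * s))⁻¹ := by
  have h0 : 0 < 1 - 2 * s := by linarith
  set v : NNReal := ⟨(1 - 2 * s)⁻¹, by positivity⟩ with hv
  have hv0 : v ≠ 0 := by
    intro h
    have : (v : ℝ) = 0 := by rw [h]; rfl
    simp only [hv] at this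
    exact (inv_pos.2 h0).ne' this
  have hvv : (v : ℝ) = (1 - 2 * s)⁻¹ := rfl
  rw [gaussianReal_of_var_ne_zero _ one_ne_zero,
    lintegral_withDensity_eq_lintegral_mul _ (measurable_gaussianPDF 0 1) (by fun_prop)]
  have : ∀ x : ℝ, (gaussianPDF 0 1 * fun x => ENNReal.ofReal (Real.exp (s * x ^ 2))) x
      = ENNReal.ofReal (√(1 - 2 * s))⁻¹ * gaussianPDF 0 v x := by
    intro x
    simp only [gaussianPDF, Pi.mul_apply, gaussianPDFReal]
    rw [← ENNReal.ofReal_mul (by positivity), ← ENNReal.ofReal_mul (by positivity), hvv]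
    congr 1
    have e1 : √(2 * Real.pi * (1 - 2 * s)⁻¹) = √(2 * Real.pi) * (√(1 - 2 * s))⁻¹ := by
      rw [Real.sqrt_mul (by positivity), Real.sqrt_inv]
    have h1 : √(1 - 2 * s) ≠ 0 := (Real.sqrt_pos.2 h0).ne'
    have h2 : √(2 * Real.pi) ≠ 0 := (Real.sqrt_pos.2 (by positivity)).ne'
    rw [e1, mul_assoc, ← Real.exp_add]
    have e2 : -(x - 0) ^ 2 / (2 * ((1 : NNReal) : ℝ)) + s * x ^ 2
        = -(x - 0) ^ 2 / (2 * (1 - 2 * s)⁻¹) := by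
      field_simp
      simp
      ring
    rw [e2]
    simp only [NNReal.coe_one, mul_one]
    field_simp
  simp_rw [this]
  rw [lintegral_const_mul _ (measurable_gaussianPDF 0 v), lintegral_gaussianPDF_eq_one _ hv0,
    mul_one]

theorem inv_sqrt_one_sub_le {s : ℝ} (hs0 : 0 ≤ s) (hs : s ≤ 1 / 4) :
    (√(1 - 2 * s))⁻¹ ≤ Real.exp (2 * s) := by
  have h1 : Real.exp (-(2 * s)) ≤ √(1 - 2 * s) := by
    apply Real.le_sqrt_of_sq_le
    rw [← Real.exp_nat_mul]
    have h2 : 1 + 4 * s ≤ Real.exp (4 * s) := by linarith [Real.add_one_le_exp (4 * s)]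
    have h3 : Real.exp (((2 : ℕ) : ℝ) * -(2 * s)) = (Real.exp (4 * s))⁻¹ := by
      rw [← Real.exp_neg]; congr 1; push_cast; ring
    rw [h3, inv_le_comm₀ (Real.exp_pos _) (by linarith)]
    refine le_trans ?_ h2
    rw [inv_le_iff_one_le_mul₀ (by linarith)]
    nlinarith
  rw [inv_le_comm₀ (lt_of_lt_of_le (Real.exp_pos _) h1) (Real.exp_pos _), ← Real.exp_neg]
  exact h1

theorem lintegral_exp_sq_gaussianReal_le {s : ℝ} (hs0 : 0 ≤ s) (hs : s ≤ 1 / 4) :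
    ∫⁻ x, ENNReal.ofReal (Real.exp (s * x ^ 2)) ∂(gaussianReal 0 1)
      ≤ ENNReal.ofReal (Real.exp (2 * s)) := by
  rw [lintegral_exp_sq_gaussianReal (by linarith)]
  exact ENNReal.ofReal_le_ofReal (inv_sqrt_one_sub_le hs0 hs)

theorem sqDom_gaussianReal_scale {a : ℝ} (ha : 1 ≤ a) :
    SqDom ((gaussianReal 0 1).map (fun x => a⁻¹ * x)) (gaussianReal 0 1)
      (ENNReal.ofReal (Real.exp ((a ^ 2 - 1) ^ 2))) := by
  have ha0 : 0 < a := by linarith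
  obtain ⟨v, hv, hmap⟩ : ∃ v : NNReal, (v : ℝ) = a⁻¹ ^ 2 ∧
      (gaussianReal 0 1).map (fun x => a⁻¹ * x) = gaussianReal 0 v :=
    ⟨⟨a⁻¹ ^ 2, sq_nonneg _⟩, rfl, by rw [gaussianReal_map_const_mul, mul_one, mul_zero]; rfl⟩
  have hv0 : v ≠ 0 := by
    rintro rfl
    have : 0 < a⁻¹ ^ 2 := by positivity
    simp [← hv] at this
  have key : (gaussianReal 0 1).map (fun x => a⁻¹ * x) = (gaussianReal 0 1).withDensity
      (fun x => ENNReal.ofReal (a * Real.exp (-(a ^ 2 - 1) / 2 * x ^ 2))) := by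
    rw [hmap, gaussianReal_of_var_ne_zero _ hv0,
      gaussianReal_of_var_ne_zero _ one_ne_zero,
      ← withDensity_mul _ (measurable_gaussianPDF 0 1) (by fun_prop)]
    congr 1
    ext x
    simp only [gaussianPDF, Pi.mul_apply, gaussianPDFReal]
    rw [← ENNReal.ofReal_mul (by positivity)]
    congr 1
    have e1 : √(2 * Real.pi * (v : ℝ))
        = √(2 * Real.pi) * a⁻¹ := by
      rw [hv, Real.sqrt_mul (by positivity), Real.sqrt_sq (by positivity)]
    have h2 : √(2 * Real.pi) ≠ 0 := (Real.sqrt_pos.2 (by positivity)).ne'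
    have e2 : -(x - 0) ^ 2 / (2 * (v : ℝ))
        = -(x - 0) ^ 2 / (2 * ((1 : NNReal) : ℝ)) + -(a ^ 2 - 1) / 2 * x ^ 2 := by
      rw [hv]
      simp
      field_simp
      ring
    rw [e1, e2, Real.exp_add]
    simp only [NNReal.coe_one, mul_one]
    field_simp
  rw [key]
  refine (SqDom.withDensity _ (by fun_prop)).mono ?_
  have : ∀ x : ℝ, ENNReal.ofReal (a * Real.exp (-(a ^ 2 - 1) / 2 * x ^ 2)) ^ 2
      = ENNReal.ofReal (a ^ 2) * ENNReal.ofReal (Real.exp (-(a ^ 2 - 1) * x ^ 2)) := by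
    intro x
    rw [← ENNReal.ofReal_pow (by positivity), ← ENNReal.ofReal_mul (by positivity), mul_pow,
      ← Real.exp_nat_mul]
    congr 3
    push_cast
    ring
  simp_rw [this]
  have ha2 : 1 ≤ a ^ 2 := one_le_pow₀ ha
  rw [lintegral_const_mul _ (by fun_prop), lintegral_exp_sq_gaussianReal (by linarith),
    ← ENNReal.ofReal_mul (by positivity)]
  refine ENNReal.ofReal_le_ofReal ?_
  set l := a ^ 2 with hl
  have h1 : 0 < √(1 - 2 * -(l - 1)) := Real.sqrt_pos.2 (by linarith)
  rw [← div_eq_mul_inv, div_le_iff₀ h1]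
  refine le_of_sq_le_sq ?_ (by positivity)
  rw [mul_pow, Real.sq_sqrt (by linarith), ← Real.exp_nat_mul]
  have h2 := Real.add_one_le_exp (((2 : ℕ) : ℝ) * (l - 1) ^ 2)
  push_cast at h2 ⊢
  nlinarith [mul_nonneg (sq_nonneg (l - 1)) (sub_nonneg.2 ha2)]

end MatrixNormal

namespace MatrixNormal

/-! ### Standard Gaussian vectors -/

theorem lintegral_pi_prod {ι : Type*} [Fintype ι] {X : ι → Type*} [∀ i, MeasurableSpace (X i)]
    (μ : ∀ i, Measure (X i)) [∀ i, SigmaFinite (μ i)] {g : ∀ i, X i → ℝ≥0∞}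
    (hg : ∀ i, Measurable (g i)) :
    ∫⁻ x, ∏ i, g i (x i) ∂(Measure.pi μ) = ∏ i, ∫⁻ y, g i y ∂(μ i) := by
  classical
  rcases isEmpty_or_nonempty (∀ i, X i) with he | ⟨⟨x₀⟩⟩
  · rw [lintegral_of_isEmpty]
    obtain ⟨i, hi⟩ := isEmpty_pi.1 he
    exact (Finset.prod_eq_zero (Finset.mem_univ i) (lintegral_of_isEmpty _ _)).symm
  have key : ∀ (s : Finset ι) (x : ∀ i, X i),
      (∫⋯∫⁻_s, (fun y => ∏ i ∈ s, g i (y i)) ∂μ) x = ∏ i ∈ s, ∫⁻ y, g i y ∂(μ i) := by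
    intro s
    induction s using Finset.induction_on with
    | empty => intro x; simp
    | insert i s hi ih =>
      intro x
      rw [lmarginal_insert' _ (by fun_prop) hi, Finset.prod_insert hi, ← ih x]
      have h1 : (fun x : ∀ i, X i =>
          ∫⁻ xi, ∏ j ∈ insert i s, g j (Function.update x i xi j) ∂μ i)
          = fun x => (∫⁻ y, g i y ∂μ i) * ∏ j ∈ s, g j (x j) := by
        ext x
        rw [← lintegral_mul_const _ (hg i)]
        refine lintegral_congr fun xi => ?_
        rw [Finset.prod_insert hi, Function.update_self]
        congr 1
        refine Finset.prod_congr rfl fun j hj => ?_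
        rw [Function.update_of_ne (by rintro rfl; exact hi hj)]
      rw [h1]
      simp only [lmarginal]
      rw [lintegral_const_mul]
      exact (Finset.measurable_prod s fun j _ => (hg j).comp (measurable_pi_apply j)).comp
        measurable_updateFinset
  have := key Finset.univ x₀
  rwa [← lintegral_eq_lmarginal_univ] at this

theorem pi_withDensity {ι : Type*} [Fintype ι] {X : ι → Type*} [∀ i, MeasurableSpace (X i)]
    (μ : ∀ i, Measure (X i)) [∀ i, SigmaFinite (μ i)] {g : ∀ i, X i → ℝ≥0∞}
    (hg : ∀ i, Measurable (g i)) [∀ i, SigmaFinite ((μ i).withDensity (g i))] :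
    Measure.pi (fun i => (μ i).withDensity (g i))
      = (Measure.pi μ).withDensity (fun x => ∏ i, g i (x i)) := by
  refine Measure.pi_eq fun s hs => ?_
  rw [withDensity_apply _ (MeasurableSet.univ_pi hs),
    ← lintegral_indicator (MeasurableSet.univ_pi hs)]
  have : ∀ x : ∀ i, X i, (Set.univ.pi s).indicator (fun x => ∏ i, g i (x i)) x
      = ∏ i, (s i).indicator (g i) (x i) := by
    intro x
    by_cases h : x ∈ Set.univ.pi s
    · rw [Set.indicator_of_mem h]
      exact Finset.prod_congr rfl fun i _ => (Set.indicator_of_mem (h i trivial) _).symm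
    · rw [Set.indicator_of_notMem h]
      obtain ⟨i, hi⟩ : ∃ i, x i ∉ s i := by simpa [Set.mem_pi] using h
      exact (Finset.prod_eq_zero (Finset.mem_univ i) (Set.indicator_of_notMem hi _)).symm
  simp_rw [this]
  rw [lintegral_pi_prod μ fun i => (hg i).indicator (hs i)]
  refine Finset.prod_congr rfl fun i _ => ?_
  rw [withDensity_apply _ (hs i), lintegral_indicator (hs i)]

/-- The standard Gaussian measure on `ι → ℝ`. -/
noncomputable abbrev stdPi (ι : Type*) [Fintype ι] : Measure (ι → ℝ) :=
  Measure.pi fun _ : ι => gaussianReal 0 1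

variable {ι : Type*} [Fintype ι]

theorem stdPi_absolutelyContinuous : stdPi ι ≪ (volume : Measure (ι → ℝ)) := by
  have h : (gaussianReal 0 1) = (volume : Measure ℝ).withDensity (gaussianPDF 0 1) :=
    gaussianReal_of_var_ne_zero _ one_ne_zero
  have : IsProbabilityMeasure ((volume : Measure ℝ).withDensity (gaussianPDF 0 1)) := by
    rw [← h]; infer_instance
  rw [stdPi, h, pi_withDensity _ fun _ => measurable_gaussianPDF 0 1]
  exact withDensity_absolutelyContinuous _ _

/-- The density of the standard Gaussian measure on `ι → ℝ`. -/
noncomputable def stdDensity (ι : Type*) [Fintype ι] (x : ι → ℝ) : ℝ :=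
  (√(2 * Real.pi))⁻¹ ^ Fintype.card ι * Real.exp (-(x ⬝ᵥ x) / 2)

theorem stdDensity_nonneg (x : ι → ℝ) : 0 ≤ stdDensity ι x := by
  unfold stdDensity; positivity

theorem continuous_stdDensity : Continuous (stdDensity ι) := by
  unfold stdDensity; fun_prop

theorem stdPi_eq_withDensity :
    stdPi ι = volume.withDensity (fun x => ENNReal.ofReal (stdDensity ι x)) := by
  have h : (gaussianReal 0 1) = (volume : Measure ℝ).withDensity (gaussianPDF 0 1) :=
    gaussianReal_of_var_ne_zero _ one_ne_zero
  have : IsProbabilityMeasure ((volume : Measure ℝ).withDensity (gaussianPDF 0 1)) := by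
    rw [← h]; infer_instance
  rw [stdPi, h, pi_withDensity _ fun _ => measurable_gaussianPDF 0 1]
  congr 1
  ext x
  simp only [gaussianPDF]
  rw [← ENNReal.ofReal_prod_of_nonneg fun i _ => gaussianPDFReal_nonneg _ _ _]
  congr 1
  simp only [gaussianPDFReal, Finset.prod_mul_distrib, ← Real.exp_sum, stdDensity]
  simp [dotProduct, Finset.sum_div, neg_div, Finset.sum_neg_distrib, pow_two]

theorem lintegral_stdPi {f : (ι → ℝ) → ℝ≥0∞} (hf : Measurable f) :
    ∫⁻ x, f x ∂(stdPi ι) = ∫⁻ x, ENNReal.ofReal (stdDensity ι x) * f x := by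
  rw [stdPi_eq_withDensity, lintegral_withDensity_eq_lintegral_mul _ _ hf]
  · rfl
  · exact continuous_stdDensity.measurable.ennreal_ofReal

theorem sqDom_stdPi_shift (a : ι → ℝ) :
    SqDom ((stdPi ι).map (fun x => x + a)) (stdPi ι)
      (ENNReal.ofReal (Real.exp (∑ i, a i ^ 2))) := by
  have h1 : (stdPi ι).map (fun x => x + a) = Measure.pi fun i => gaussianReal (a i) 1 := by
    have := Measure.pi_map_pi (μ := fun _ : ι => gaussianReal 0 1)
      (f := fun i y => y + a i) (hμ := fun i => by
        rw [gaussianReal_map_add_const]; infer_instance) (fun i => by fun_prop)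
    simp only [gaussianReal_map_add_const, zero_add] at this
    exact this
  rw [h1, Real.exp_sum, ENNReal.ofReal_prod_of_nonneg fun i _ => (Real.exp_pos _).le]
  exact SqDom.pi fun i => sqDom_gaussianReal_shift (a i)

section Shear

variable [DecidableEq ι]

theorem det_one_add_of_sq_eq_zero {N : Matrix ι ι ℝ} (hN : N * N = 0) : (1 + N).det = 1 := by
  have h : IsNilpotent (-N) := ⟨2, by rw [pow_two, neg_mul_neg, hN]⟩
  have h2 := (Matrix.isNilpotent_charpoly_sub_pow_of_isNilpotent h).eq_zero
  have h3 := congrArg (Polynomial.eval 1) h2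
  rw [Polynomial.eval_sub, Matrix.eval_charpoly] at h3
  simp only [map_one, sub_neg_eq_add, Polynomial.eval_pow, Polynomial.eval_X, one_pow,
    Polynomial.eval_zero] at h3
  linarith

theorem measurePreserving_add_mulVec {N : Matrix ι ι ℝ} (hN : N * N = 0) :
    MeasurePreserving (fun x : ι → ℝ => x + N.mulVec x) volume volume := by
  have h := Real.map_matrix_volume_pi_eq_smul_volume_pi (M := 1 + N)
    (by rw [det_one_add_of_sq_eq_zero hN]; exact one_ne_zero)
  rw [det_one_add_of_sq_eq_zero hN] at h
  have e : (⇑(Matrix.toLin' (1 + N)) : (ι → ℝ) → ι → ℝ) = fun x => x + N.mulVec x := by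
    ext x i
    simp
  rw [e] at h
  refine ⟨by fun_prop, ?_⟩
  simpa using h

/-- The second moment of the density of the sheared Gaussian is computed by a second shear, which
turns it into an exponential moment of `‖N u‖²`. -/
theorem sqDom_stdPi_shear {N : Matrix ι ι ℝ} (hN : N * N = 0) :
    SqDom ((stdPi ι).map (fun x => x + N.mulVec x)) (stdPi ι)
      (∫⁻ u, ENNReal.ofReal (Real.exp (N.mulVec u ⬝ᵥ N.mulVec u)) ∂(stdPi ι)) := by
  have hNN : ∀ x : ι → ℝ, N.mulVec (N.mulVec x) = 0 := by
    intro x; rw [Matrix.mulVec_mulVec, hN, Matrix.zero_mulVec]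
  set L : (ι → ℝ) → ℝ := fun w => Real.exp (w ⬝ᵥ N.mulVec w - N.mulVec w ⬝ᵥ N.mulVec w / 2)
    with hLdef
  have hLm : Measurable fun w => ENNReal.ofReal (L w) := by
    refine Measurable.ennreal_ofReal (Continuous.measurable ?_)
    fun_prop
  have hgm : Measurable fun w => ENNReal.ofReal (stdDensity ι w) :=
    continuous_stdDensity.measurable.ennreal_ofReal
  have hdot : ∀ w : ι → ℝ, N.mulVec w ⬝ᵥ w = w ⬝ᵥ N.mulVec w := fun w => dotProduct_comm _ _
  have key : (stdPi ι).map (fun x => x + N.mulVec x)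
      = (stdPi ι).withDensity (fun w => ENNReal.ofReal (L w)) := by
    refine Measure.ext_of_lintegral _ fun f hf => ?_
    rw [lintegral_map hf (by fun_prop), lintegral_stdPi (by fun_prop),
      lintegral_withDensity_eq_lintegral_mul _ hLm hf, lintegral_stdPi (hLm.mul hf)]
    have hF : Measurable fun w => ENNReal.ofReal (stdDensity ι w) *
        (ENNReal.ofReal (L w) * f w) := hgm.mul (hLm.mul hf)
    refine Eq.trans ?_ ((measurePreserving_add_mulVec hN).lintegral_comp hF)
    refine lintegral_congr fun x => ?_
    rw [Pi.mul_apply, ← mul_assoc, ← ENNReal.ofReal_mul (stdDensity_nonneg _)]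
    congr 2
    simp only [stdDensity, hLdef]
    rw [mul_assoc, ← Real.exp_add]
    congr 2
    simp only [Matrix.mulVec_add, hNN, add_zero, dotProduct_add, add_dotProduct, hdot]
    ring
  rw [key]
  refine (SqDom.withDensity _ hLm).mono (le_of_eq ?_)
  rw [lintegral_stdPi (hLm.pow_const 2), lintegral_stdPi]
  swap
  · refine Measurable.ennreal_ofReal (Continuous.measurable ?_)
    fun_prop
  have hN2 : ((2 : ℝ) • N) * ((2 : ℝ) • N) = 0 := by simp [hN]
  have hF : Measurable fun w => ENNReal.ofReal (stdDensity ι w) * ENNReal.ofReal (L w) ^ 2 :=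
    hgm.mul (hLm.pow_const 2)
  rw [← (measurePreserving_add_mulVec hN2).lintegral_comp hF]
  refine lintegral_congr fun x => ?_
  rw [← ENNReal.ofReal_pow (Real.exp_pos _).le, ← ENNReal.ofReal_mul (stdDensity_nonneg _),
    ← ENNReal.ofReal_mul (stdDensity_nonneg _)]
  congr 1
  simp only [stdDensity]
  rw [mul_assoc, mul_assoc, ← Real.exp_nat_mul, ← Real.exp_add, ← Real.exp_add]
  congr 2
  simp only [Matrix.mulVec_add, hNN, dotProduct_add, add_dotProduct, hdot,
    Matrix.smul_mulVec, Matrix.mulVec_smul, smul_zero, add_zero, smul_dotProduct, dotProduct_smul,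
    smul_eq_mul]
  push_cast
  ring

end Shear

theorem map_dotProduct_stdPi {a : ι → ℝ} (ha : a ⬝ᵥ a = 1) :
    (stdPi ι).map (fun u => a ⬝ᵥ u) = gaussianReal 0 1 := by
  have h := IsGaussian.map_eq_gaussianReal (μ := stdGaussian (EuclideanSpace ℝ ι))
    (innerSL ℝ (WithLp.toLp 2 a))
  rw [integral_strongDual_stdGaussian, variance_dual_stdGaussian, innerSL_apply_norm,
    EuclideanSpace.real_norm_sq_eq] at h
  have e : (∑ i, (WithLp.toLp 2 a) i ^ 2).toNNReal = 1 := by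
    have : (∑ i, (WithLp.toLp 2 a) i ^ 2) = 1 := by
      rw [← ha]; simp [dotProduct, pow_two]
    rw [this]; simp
  rw [e, ← map_pi_eq_stdGaussian, Measure.map_map (by fun_prop) (by fun_prop)] at h
  rw [← h]
  congr 1
  ext u
  simp [PiLp.inner_apply, dotProduct, mul_comm]

/-- The bound depends on the Frobenius norm of `A` only, not on the dimensions: by Jensen's
inequality `exp ‖A u‖²` is at most a convex combination of functions `exp (s ⟨a, u⟩²)` with
unit vectors `a`. -/
theorem lintegral_exp_mulVec_sq_le {κ : Type*} [Fintype κ] (A : Matrix κ ι ℝ)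
    (hA : ∑ i, ∑ j, A i j ^ 2 ≤ 1 / 4) :
    ∫⁻ u, ENNReal.ofReal (Real.exp (A.mulVec u ⬝ᵥ A.mulVec u)) ∂(stdPi ι)
      ≤ ENNReal.ofReal (Real.exp (2 * ∑ i, ∑ j, A i j ^ 2)) := by
  set s := ∑ i, ∑ j, A i j ^ 2 with hs
  set r : κ → ℝ := fun i => ∑ j, A i j ^ 2 with hr
  have hr0 : ∀ i, 0 ≤ r i := fun i => Finset.sum_nonneg fun j _ => sq_nonneg _
  have hs0 : 0 ≤ s := Finset.sum_nonneg fun i _ => hr0 i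
  rcases hs0.eq_or_lt with h0 | hpos
  · have hA0 : A = 0 := by
      ext i j
      have h1 := (Finset.sum_eq_zero_iff_of_nonneg fun i _ => hr0 i).1 h0.symm i (Finset.mem_univ i)
      have h2 := (Finset.sum_eq_zero_iff_of_nonneg fun j _ => sq_nonneg _).1 h1 j
        (Finset.mem_univ j)
      simpa using h2
    rw [← h0]
    simp [hA0]
  set a : κ → ι → ℝ := fun i j => (√(r i))⁻¹ * A i j with ha
  have haA : ∀ i u, r i * (a i ⬝ᵥ u) ^ 2 = (A.mulVec u i) ^ 2 := by
    intro i u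
    have e : a i ⬝ᵥ u = (√(r i))⁻¹ * A.mulVec u i := by
      simp [ha, dotProduct, Matrix.mulVec, Finset.mul_sum, mul_assoc]
    rw [e, mul_pow, inv_pow, Real.sq_sqrt (hr0 i)]
    rcases (hr0 i).eq_or_lt with h | h
    · have : A.mulVec u i = 0 := by
        simp only [Matrix.mulVec, dotProduct]
        refine Finset.sum_eq_zero fun j hj => ?_
        have h2 := (Finset.sum_eq_zero_iff_of_nonneg fun j _ => sq_nonneg _).1 h.symm j hj
        rw [pow_eq_zero_iff two_ne_zero] at h2
        rw [h2, zero_mul]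
      simp [this]
    · field_simp
  have hw : ∑ i, r i / s = 1 := by
    rw [← Finset.sum_div, div_self hpos.ne']
  have hJ : ∀ u : ι → ℝ, Real.exp (A.mulVec u ⬝ᵥ A.mulVec u)
      ≤ ∑ i, (r i / s) * Real.exp (s * (a i ⬝ᵥ u) ^ 2) := by
    intro u
    have h := convexOn_exp.map_sum_le (t := Finset.univ) (w := fun i => r i / s)
      (p := fun i => s * (a i ⬝ᵥ u) ^ 2) (fun i _ => by have := hr0 i; positivity) hw
      (fun i _ => Set.mem_univ _)
    simp only [smul_eq_mul] at h
    refine le_trans (le_of_eq ?_) h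
    congr 1
    simp only [dotProduct]
    refine Finset.sum_congr rfl fun i _ => ?_
    rw [← pow_two, ← haA]
    simp only [dotProduct]
    field_simp
  calc ∫⁻ u, ENNReal.ofReal (Real.exp (A.mulVec u ⬝ᵥ A.mulVec u)) ∂(stdPi ι)
      ≤ ∫⁻ u, ∑ i, ENNReal.ofReal (r i / s) * ENNReal.ofReal (Real.exp (s * (a i ⬝ᵥ u) ^ 2))
          ∂(stdPi ι) := by
        refine lintegral_mono fun u => (ENNReal.ofReal_le_ofReal (hJ u)).trans (le_of_eq ?_)
        rw [ENNReal.ofReal_sum_of_nonneg fun i _ => by have := hr0 i; positivity]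
        refine Finset.sum_congr rfl fun i _ => ?_
        rw [ENNReal.ofReal_mul (by have := hr0 i; positivity)]
    _ = ∑ i, ENNReal.ofReal (r i / s) *
          ∫⁻ u, ENNReal.ofReal (Real.exp (s * (a i ⬝ᵥ u) ^ 2)) ∂(stdPi ι) := by
        rw [lintegral_finsetSum]
        · refine Finset.sum_congr rfl fun i _ => lintegral_const_mul _ ?_
          exact Measurable.ennreal_ofReal (Continuous.measurable (by fun_prop))
        · intro i _
          exact (Measurable.ennreal_ofReal (Continuous.measurable (by fun_prop))).const_mul _
    _ ≤ ∑ i, ENNReal.ofReal (r i / s) * ENNReal.ofReal (Real.exp (2 * s)) := by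
        refine Finset.sum_le_sum fun i _ => ?_
        rcases (hr0 i).eq_or_lt with h | h
        · simp [← h]
        · refine mul_le_mul_right ?_ _
          have hai : a i ⬝ᵥ a i = 1 := by
            have e : a i ⬝ᵥ a i = (√(r i))⁻¹ ^ 2 * r i := by
              simp only [ha, dotProduct, hr, Finset.mul_sum]
              exact Finset.sum_congr rfl fun j _ => by ring
            rw [e, inv_pow, Real.sq_sqrt h.le, inv_mul_cancel₀ h.ne']
          have hm := lintegral_map (μ := stdPi ι)
            (f := fun y : ℝ => ENNReal.ofReal (Real.exp (s * y ^ 2)))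
            (g := fun u => a i ⬝ᵥ u) (by fun_prop)
            (Continuous.measurable (by fun_prop))
          rw [map_dotProduct_stdPi hai] at hm
          rw [← hm]
          exact lintegral_exp_sq_gaussianReal_le hs0 hA
    _ = ENNReal.ofReal (Real.exp (2 * s)) := by
        rw [← Finset.sum_mul, ← ENNReal.ofReal_sum_of_nonneg fun i _ => by
          have := hr0 i; positivity, hw, ENNReal.ofReal_one, one_mul]

end MatrixNormal

namespace MatrixNormal

/-! ### The matrix normal law as an image of Gaussian noise -/

theorem multivariateGaussian_mul_transpose {κ : Type*} [Fintype κ] [DecidableEq κ]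
    (M : Matrix κ κ ℝ) :
    multivariateGaussian 0 (M * M.transpose)
      = (stdPi κ).map (fun u => WithLp.toLp 2 (M.mulVec u)) := by
  have hS : (M * M.transpose).PosSemidef := by
    simpa using Matrix.posSemidef_self_mul_conjTranspose M
  have h1 : (stdPi κ).map (fun u => WithLp.toLp 2 (M.mulVec u))
      = (stdGaussian (EuclideanSpace ℝ κ)).map (Matrix.toEuclideanCLM (𝕜 := ℝ) M) := by
    rw [← map_pi_eq_stdGaussian, Measure.map_map (by fun_prop) (by fun_prop)]
    rfl
  rw [h1]
  refine Measure.ext_of_charFun ?_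
  ext t
  rw [charFun_multivariateGaussian hS, charFun_apply, integral_map (by fun_prop) (by fun_prop)]
  have h2 : ∀ x : EuclideanSpace ℝ κ, inner ℝ (Matrix.toEuclideanCLM (𝕜 := ℝ) M x) t
      = inner ℝ x (WithLp.toLp 2 (M.transpose.mulVec t.ofLp)) := by
    intro x
    simp only [PiLp.inner_apply, RCLike.inner_apply, conj_trivial]
    have := Matrix.dotProduct_mulVec t.ofLp M x.ofLp
    simp only [dotProduct, ← Matrix.mulVec_transpose] at this
    exact this
  simp_rw [h2]
  rw [← charFun_apply, charFun_stdGaussian, ← Complex.ofReal_pow,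
    EuclideanSpace.real_norm_sq_eq]
  congr 1
  have h3 : t.ofLp ⬝ᵥ (M * M.transpose).mulVec t.ofLp
      = ∑ i, (M.transpose.mulVec t.ofLp i) ^ 2 := by
    rw [← Matrix.mulVec_mulVec, Matrix.dotProduct_mulVec, ← Matrix.mulVec_transpose]
    simp [dotProduct, pow_two]
  rw [h3]
  simp [neg_div]

/-- Arrays of standard Gaussian noise: `n` samples, each consisting of `d₂` columns in `ℝ^d₁`. -/
abbrev Noise (n d₁ d₂ : ℕ) : Type := Fin n → Fin d₂ → Fin d₁ → ℝ

/-- The law of an array of independent standard Gaussians. -/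
noncomputable abbrev noiseLaw (n d₁ d₂ : ℕ) : Measure (Noise n d₁ d₂) :=
  Measure.pi fun _ => Measure.pi fun _ => stdPi (Fin d₁)

variable {n d₁ d₂ : ℕ}

/-- Replaces the columns of each sample by their linear combinations with coefficients from the
rows of `L`. -/
def colMix (L : Matrix (Fin d₂) (Fin d₂) ℝ) (Z : Noise n d₁ d₂) : Noise n d₁ d₂ :=
  fun i j => ∑ l, L j l • Z i l

/-- Applies `T` to every column and reads the result as a tuple of samples. -/
def toSamples (T : Matrix (Fin d₁) (Fin d₁) ℝ) (Z : Noise n d₁ d₂) : Samples n d₁ d₂ :=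
  fun i => WithLp.toLp 2 fun p => T.mulVec (Z i p.2) p.1

theorem map_stdPi_columns :
    (Measure.pi fun _ : Fin d₂ => stdPi (Fin d₁)).map
      (fun (z : Fin d₂ → Fin d₁ → ℝ) (p : Fin d₁ × Fin d₂) => z p.2 p.1)
      = stdPi (Fin d₁ × Fin d₂) := by
  refine (Measure.pi_eq fun s hs => ?_).symm
  rw [Measure.map_apply (by fun_prop) (MeasurableSet.univ_pi hs)]
  have : (fun (z : Fin d₂ → Fin d₁ → ℝ) (p : Fin d₁ × Fin d₂) => z p.2 p.1) ⁻¹' (Set.univ.pi s)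
      = Set.univ.pi fun j => Set.univ.pi fun a => s (a, j) := by
    ext z
    simp only [Set.mem_preimage, Set.mem_pi, Set.mem_univ, true_implies, Prod.forall]
    exact forall_comm
  rw [this, Measure.pi_pi]
  simp_rw [Measure.pi_pi]
  rw [Fintype.prod_prod_type, Finset.prod_comm]

theorem law_eq_map {Θ T : Matrix (Fin d₁) (Fin d₁) ℝ} {L : Matrix (Fin d₂) (Fin d₂) ℝ} {t : ℝ}
    (hL : L.det = 1) (ht : 0 < t) (hT : T * T.transpose = t⁻¹ • Θ⁻¹) :
    law n Θ (t • (L * L.transpose)⁻¹)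
      = (noiseLaw n d₁ d₂).map (fun Z => toSamples T (colMix L Z)) := by
  have hu : IsUnit (L * L.transpose).det := by simp [hL]
  have hinv : (t • (L * L.transpose)⁻¹)⁻¹ = t⁻¹ • (L * L.transpose) := by
    refine Matrix.inv_eq_left_inv ?_
    rw [Matrix.smul_mul, Matrix.mul_smul, smul_smul, Matrix.mul_nonsing_inv _ hu,
      inv_mul_cancel₀ ht.ne', one_smul]
  have hcov : (Θ ⊗ₖ (t • (L * L.transpose)⁻¹))⁻¹ = (T ⊗ₖ L) * (T ⊗ₖ L).transpose := by
    rw [Matrix.inv_kronecker, hinv, Matrix.kronecker_smul, ← Matrix.smul_kronecker, ← hT,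
      Matrix.mul_kronecker_mul]
    congr 1
  have hone : multivariateGaussian 0 (Θ ⊗ₖ (t • (L * L.transpose)⁻¹))⁻¹
      = (Measure.pi fun _ : Fin d₂ => stdPi (Fin d₁)).map
        (fun z => WithLp.toLp 2 fun p : Fin d₁ × Fin d₂ =>
          T.mulVec (∑ l, L p.2 l • z l) p.1) := by
    rw [hcov, multivariateGaussian_mul_transpose, ← map_stdPi_columns,
      Measure.map_map (by fun_prop) (by fun_prop)]
    congr 1
    ext z p
    simp only [Function.comp_apply, Matrix.mulVec, dotProduct, Fintype.sum_prod_type,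
      Finset.sum_apply, Pi.smul_apply, smul_eq_mul, Finset.mul_sum]
    exact Finset.sum_congr rfl fun b _ => Finset.sum_congr rfl fun l _ => by
      rw [Matrix.kroneckerMap_apply]
      ring
  have hmeas : Measurable (fun z : Fin d₂ → Fin d₁ → ℝ => (WithLp.toLp 2
      fun p : Fin d₁ × Fin d₂ => T.mulVec (∑ l, L p.2 l • z l) p.1 :
        EuclideanSpace ℝ (Fin d₁ × Fin d₂))) :=
    Continuous.measurable (by fun_prop)
  unfold law
  rw [hone]
  have : IsProbabilityMeasure ((Measure.pi fun _ : Fin d₂ => stdPi (Fin d₁)).map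
        (fun z => (WithLp.toLp 2 fun p : Fin d₁ × Fin d₂ =>
          T.mulVec (∑ l, L p.2 l • z l) p.1 : EuclideanSpace ℝ (Fin d₁ × Fin d₂)))) :=
    Measure.isProbabilityMeasure_map hmeas.aemeasurable
  rw [← Measure.pi_map_pi fun _ => hmeas.aemeasurable]
  rfl

/-! ### Unimodular column factors -/

/-- The entries of `H` below the first `m` rows and in the first `m` columns. It squares to zero,
so that `1 + lowerBlock m H` is a unipotent block matrix. -/
def lowerBlock (m : ℕ) (H : Fin d₂ → Fin d₂ → ℝ) : Matrix (Fin d₂) (Fin d₂) ℝ :=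
  Matrix.of fun j l => if l.val < m ∧ m ≤ j.val then H j l else 0

/-- The projection onto the first `m` coordinates. -/
def firstProj (d₂ m : ℕ) : Matrix (Fin d₂) (Fin d₂) ℝ :=
  Matrix.diagonal fun j => if j.val < m then 1 else 0

theorem lowerBlock_mul_self (m : ℕ) (H : Fin d₂ → Fin d₂ → ℝ) :
    lowerBlock m H * lowerBlock m H = 0 := by
  ext i j
  simp only [Matrix.mul_apply, lowerBlock, Matrix.of_apply, Matrix.zero_apply]
  refine Finset.sum_eq_zero fun l _ => ?_
  by_cases h : l.val < m
  · rw [if_neg (c := j.val < m ∧ m ≤ l.val) (by omega), mul_zero]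
  · rw [if_neg (by omega), zero_mul]

theorem det_one_add_lowerBlock (m : ℕ) (H : Fin d₂ → Fin d₂ → ℝ) :
    (1 + lowerBlock m H).det = 1 :=
  det_one_add_of_sq_eq_zero (lowerBlock_mul_self m H)

/-- If the columns with index at least `m` are combinations of the first `m` columns, then
they can be absorbed into the random coefficients. -/
theorem colMix_one_add_lowerBlock {m : ℕ} {Z : Noise n d₁ d₂} {S : Fin d₂ → Fin d₂ → ℝ}
    (hS : ∀ i j, m ≤ j.val → Z i j = ∑ l, lowerBlock m S j l • Z i l)
    (H : Fin d₂ → Fin d₂ → ℝ) :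
    colMix (1 + lowerBlock m H) Z = colMix (firstProj d₂ m + lowerBlock m (H + S)) Z := by
  ext i j : 2
  have hadd : lowerBlock m (H + S) = lowerBlock m H + lowerBlock m S := by
    ext a b
    simp only [lowerBlock, Matrix.of_apply, Matrix.add_apply, Pi.add_apply]
    split_ifs <;> simp
  simp only [colMix, hadd, Matrix.add_apply, add_smul, Finset.sum_add_distrib]
  have h1 : ∑ l, (1 : Matrix (Fin d₂) (Fin d₂) ℝ) j l • Z i l = Z i j := by
    simp [Matrix.one_apply]
  have h2 : ∑ l, firstProj d₂ m j l • Z i l = if j.val < m then Z i j else 0 := by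
    simp only [firstProj, Matrix.diagonal_apply, ite_smul, zero_smul, Finset.sum_ite_eq,
      Finset.mem_univ, if_true, one_smul]
  rw [h1, h2]
  by_cases hj : j.val < m
  · rw [if_pos hj]
    have : ∑ l, lowerBlock m S j l • Z i l = 0 := by
      refine Finset.sum_eq_zero fun l _ => ?_
      simp only [lowerBlock, Matrix.of_apply]
      rw [if_neg (by omega), zero_smul]
    rw [this, add_zero]
  · rw [if_neg hj, ← hS i j (by omega), zero_add, add_comm]

/-- Applies `T` to the first `m` columns only. -/
def actFirst (m : ℕ) (T : Matrix (Fin d₁) (Fin d₁) ℝ) (Z : Noise n d₁ d₂) : Noise n d₁ d₂ :=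
  fun i j => if j.val < m then T.mulVec (Z i j) else Z i j

theorem toSamples_colMix_firstProj (m : ℕ) (T : Matrix (Fin d₁) (Fin d₁) ℝ)
    (H : Fin d₂ → Fin d₂ → ℝ) (Z : Noise n d₁ d₂) :
    toSamples T (colMix (firstProj d₂ m + lowerBlock m H) Z)
      = toSamples 1 (colMix (firstProj d₂ m + lowerBlock m H) (actFirst m T Z)) := by
  funext i
  simp only [toSamples, Matrix.one_mulVec]
  congr 1
  funext p
  simp only [colMix, Matrix.mulVec_sum, Matrix.mulVec_smul]
  refine congrFun (?_ : (_ : Fin d₁ → ℝ) = _) p.1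
  refine Finset.sum_congr rfl fun l _ => ?_
  by_cases hl : l.val < m
  · simp [actFirst, hl]
  · have : (firstProj d₂ m + lowerBlock m H) p.2 l = 0 := by
      simp only [firstProj, lowerBlock, Matrix.add_apply, Matrix.of_apply, Matrix.diagonal_apply]
      rw [if_neg (c := l.val < m ∧ m ≤ p.2.val) (by omega), add_zero]
      split_ifs with h1 h2
      · rw [h1] at h2; omega
      · rfl
      · rfl
    rw [this, zero_smul, zero_smul]

theorem sqDom_actFirst {m : ℕ} (hm : m ≤ d₂) {T : Matrix (Fin d₁) (Fin d₁) ℝ} {K : ℝ≥0∞}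
    (hK : SqDom ((stdPi (Fin d₁)).map T.mulVec) (stdPi (Fin d₁)) K) :
    SqDom ((noiseLaw n d₁ d₂).map (actFirst m T)) (noiseLaw n d₁ d₂) (K ^ (n * m)) := by
  set g : Fin d₂ → (Fin d₁ → ℝ) → Fin d₁ → ℝ :=
    fun j z => if j.val < m then T.mulVec z else z with hg
  have hgm : ∀ j, Measurable (g j) := by
    intro j
    by_cases h : j.val < m
    · simp only [hg, h, if_true]; fun_prop
    · simp only [hg, h, if_false]; fun_prop
  have hp : ∀ j, IsProbabilityMeasure ((stdPi (Fin d₁)).map (g j)) := fun j =>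
    Measure.isProbabilityMeasure_map (hgm j).aemeasurable
  have hcol : (Measure.pi fun _ : Fin d₂ => stdPi (Fin d₁)).map (fun z j => g j (z j))
      = Measure.pi fun j => (stdPi (Fin d₁)).map (g j) :=
    Measure.pi_map_pi fun j => (hgm j).aemeasurable
  have hgg : Measurable fun (z : Fin d₂ → Fin d₁ → ℝ) j => g j (z j) :=
    measurable_pi_lambda _ fun j => (hgm j).comp (measurable_pi_apply j)
  have hp2 : IsProbabilityMeasure ((Measure.pi fun _ : Fin d₂ => stdPi (Fin d₁)).map
      (fun z j => g j (z j))) := Measure.isProbabilityMeasure_map hgg.aemeasurable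
  have hall : (noiseLaw n d₁ d₂).map (actFirst m T)
      = Measure.pi fun _ : Fin n => Measure.pi fun j => (stdPi (Fin d₁)).map (g j) := by
    have := Measure.pi_map_pi (μ := fun _ : Fin n => Measure.pi fun _ : Fin d₂ => stdPi (Fin d₁))
      (f := fun _ z j => g j (z j)) (fun _ => hgg.aemeasurable)
    simp only [hcol] at this
    exact this
  have hj : ∀ j, SqDom ((stdPi (Fin d₁)).map (g j)) (stdPi (Fin d₁))
      (if j.val < m then K else 1) := by
    intro j
    by_cases h : j.val < m
    · simp only [hg, h, if_true]; exact hK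
    · simp only [hg, h, if_false]
      rw [show (fun z : Fin d₁ → ℝ => z) = id from rfl, Measure.map_id]
      exact SqDom.refl _
  rw [hall]
  have h := SqDom.pi fun _ : Fin n => SqDom.pi hj
  refine h.mono (le_of_eq ?_)
  rw [Finset.prod_const, Finset.card_univ, Fintype.card_fin, Finset.prod_ite, Finset.prod_const,
    Finset.prod_const_one, mul_one, ← pow_mul, mul_comm]
  congr 2
  rw [Fin.card_filter_val_lt, min_eq_right hm]

end MatrixNormal

namespace MatrixNormal

/-! ### Almost sure invertibility of a square block of noise -/

theorem pi_absolutelyContinuous {ι : Type*} [Fintype ι] {X : ι → Type*}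
    [∀ i, MeasurableSpace (X i)] {P Q : ∀ i, Measure (X i)} [∀ i, SigmaFinite (P i)]
    [∀ i, SigmaFinite (Q i)] (h : ∀ i, P i ≪ Q i) : Measure.pi P ≪ Measure.pi Q := by
  have e : ∀ i, (Q i).withDensity ((P i).rnDeriv (Q i)) = P i := fun i =>
    Measure.withDensity_rnDeriv_eq _ _ (h i)
  have hs : ∀ i, SigmaFinite ((Q i).withDensity ((P i).rnDeriv (Q i))) := fun i => by
    rw [e i]; infer_instance
  have := pi_withDensity Q fun i => Measure.measurable_rnDeriv (P i) (Q i)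
  simp_rw [e] at this
  rw [this]
  exact withDensity_absolutelyContinuous _ _

variable {n d₁ d₂ : ℕ}

/-- The square matrix formed by the first `n * d₁` columns of all samples stacked on top of each
other. -/
def stack (h : n * d₁ ≤ d₂) (Z : Noise n d₁ d₂) :
    Matrix (Fin n × Fin d₁) (Fin n × Fin d₁) ℝ :=
  Matrix.of fun r c => Z r.1 (Fin.castLE h (finProdFinEquiv c)) r.2

theorem continuous_stack (h : n * d₁ ≤ d₂) : Continuous (stack h) :=
  continuous_pi fun r => continuous_pi fun c => by
    simp only [stack, Matrix.of_apply]
    fun_prop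

/-- Along the line `t ↦ Z + t D`, where `stack D = 1`, the determinant is a characteristic
polynomial in `t`, so it has finitely many zeros; Fubini and translation invariance finish. -/
theorem volume_det_stack_eq_zero (h : n * d₁ ≤ d₂) :
    (volume : Measure (Noise n d₁ d₂)) {Z | (stack h Z).det = 0} = 0 := by
  set D : Noise n d₁ d₂ := fun i j b => if j = Fin.castLE h (finProdFinEquiv (i, b)) then 1 else 0
    with hD
  have hstack : ∀ (Z : Noise n d₁ d₂) (t : ℝ),
      stack h (Z + t • D) = Matrix.scalar _ t - -(stack h Z) := by
    intro Z t
    ext r c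
    simp only [stack, hD, Matrix.of_apply, Pi.add_apply, Pi.smul_apply, Matrix.sub_apply,
      Matrix.neg_apply, Matrix.scalar_apply, Matrix.diagonal_apply, Prod.mk.eta,
      (Fin.castLE_injective h).eq_iff, finProdFinEquiv.apply_eq_iff_eq, smul_eq_mul]
    by_cases hrc : r = c
    · simp [hrc, add_comm]
    · simp [hrc, Ne.symm hrc]
  set B : Set (Noise n d₁ d₂) := {Z | (stack h Z).det = 0} with hB
  have hBm : MeasurableSet B :=
    (isClosed_eq (continuous_stack h).matrix_det continuous_const).measurableSet
  set E : Set (Noise n d₁ d₂ × ℝ) := {p | p.1 + p.2 • D ∈ B} with hE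
  have hEm : MeasurableSet E := by
    have hc : Measurable fun p : Noise n d₁ d₂ × ℝ => p.1 + p.2 • D :=
      Continuous.measurable (by fun_prop)
    exact hc hBm
  have h0 : ((volume : Measure (Noise n d₁ d₂)).prod (volume : Measure ℝ)) E = 0 := by
    rw [Measure.measure_prod_null hEm]
    refine Filter.Eventually.of_forall fun Z => ?_
    refine Set.Finite.measure_zero (Set.Finite.subset
      (Polynomial.finite_setOfPred_isRoot (Matrix.charpoly_monic (-(stack h Z))).ne_zero) ?_) _
    intro t ht
    have ht' : (stack h (Z + t • D)).det = 0 := ht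
    rw [hstack] at ht'
    simp only [Set.mem_ofPred_eq, Polynomial.IsRoot]
    rw [Matrix.eval_charpoly]
    exact ht'
  rw [Measure.prod_apply_symm hEm] at h0
  have hcol : (volume : Measure (Fin d₂ → Fin d₁ → ℝ)).IsAddLeftInvariant := inferInstance
  have hinv : (volume : Measure (Noise n d₁ d₂)).IsAddLeftInvariant :=
    Measure.pi.isAddLeftInvariant fun _ : Fin n => (volume : Measure (Fin d₂ → Fin d₁ → ℝ))
  have h1 : ∀ t : ℝ, (volume : Measure (Noise n d₁ d₂)) ((fun Z => (Z, t)) ⁻¹' E)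
      = volume B := by
    intro t
    have e : (fun Z => (Z, t)) ⁻¹' E = (fun Z => t • D + Z) ⁻¹' B := by
      ext Z
      simp only [hE, Set.mem_preimage, Set.mem_ofPred_eq, add_comm]
    rw [e]
    exact measure_preimage_add volume (t • D) B
  simp_rw [h1] at h0
  rw [lintegral_const, Real.volume_univ] at h0
  simpa using h0

theorem noiseLaw_absolutelyContinuous :
    noiseLaw n d₁ d₂ ≪ (volume : Measure (Noise n d₁ d₂)) :=
  pi_absolutelyContinuous fun _ => pi_absolutelyContinuous fun _ => stdPi_absolutelyContinuous

theorem ae_exists_column_combination {m : ℕ} (hm : m = d₂ ∨ m = n * d₁ ∧ m ≤ d₂) :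
    ∀ᵐ Z ∂(noiseLaw n d₁ d₂), ∃ S : Fin d₂ → Fin d₂ → ℝ,
      ∀ i j, m ≤ j.val → Z i j = ∑ l, lowerBlock m S j l • Z i l := by
  rcases hm with rfl | ⟨rfl, h⟩
  · exact Filter.Eventually.of_forall fun Z => ⟨0, fun i j hj => absurd j.isLt (by omega)⟩
  have hae : ∀ᵐ Z ∂(noiseLaw n d₁ d₂), (stack h Z).det ≠ 0 :=
    measure_eq_zero_iff_ae_notMem.1
      (noiseLaw_absolutelyContinuous (volume_det_stack_eq_zero h))
  filter_upwards [hae] with Z hZ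
  set s : Fin d₂ → Fin n × Fin d₁ → ℝ := fun j => (stack h Z)⁻¹.mulVec fun r => Z r.1 j r.2
  refine ⟨fun j l => if hl : l.val < n * d₁ then s j (finProdFinEquiv.symm ⟨l, hl⟩) else 0,
    fun i j hj => ?_⟩
  ext b
  have hs : (stack h Z).mulVec (s j) (i, b) = Z i j b := by
    simp only [s]
    rw [Matrix.mulVec_mulVec, Matrix.mul_nonsing_inv _ (isUnit_iff_ne_zero.2 hZ),
      Matrix.one_mulVec]
  rw [← hs]
  simp only [Matrix.mulVec, dotProduct, stack, Matrix.of_apply, Finset.sum_apply, Pi.smul_apply,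
    smul_eq_mul, lowerBlock]
  refine Finset.sum_of_injOn (fun c => Fin.castLE h (finProdFinEquiv c))
    (fun a _ c _ hac => finProdFinEquiv.injective (Fin.castLE_injective h hac))
    (fun c _ => Finset.mem_coe.2 (Finset.mem_univ _)) ?_ ?_
  · intro l _ hl
    have : ¬ l.val < n * d₁ := by
      intro hlt
      exact hl ⟨finProdFinEquiv.symm ⟨l, hlt⟩, Finset.mem_coe.2 (Finset.mem_univ _), by
        simp only [Equiv.apply_symm_apply]
        rfl⟩
    simp [this]
  · intro c _
    have hlt : (Fin.castLE h (finProdFinEquiv c)).val < n * d₁ := (finProdFinEquiv c).isLt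
    rw [if_pos ⟨hlt, hj⟩, dif_pos hlt]
    have : (⟨(Fin.castLE h (finProdFinEquiv c)).val, hlt⟩ : Fin (n * d₁)) = finProdFinEquiv c :=
      Fin.ext rfl
    rw [this, Equiv.symm_apply_apply, mul_comm]

end MatrixNormal

namespace MatrixNormal

/-! ### Testing among finitely many precision matrices -/

variable {n d₁ d₂ : ℕ}

/-- The prior on the coefficients of the column factor: a standard Gaussian matrix. -/
noncomputable abbrev mixLaw (d₂ : ℕ) : Measure (Fin d₂ → Fin d₂ → ℝ) :=
  Measure.pi fun _ => stdPi (Fin d₂)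

theorem sqDom_mixLaw_shift (a : Fin d₂ → Fin d₂ → ℝ) :
    SqDom ((mixLaw d₂).map (fun H => H + a)) (mixLaw d₂)
      (ENNReal.ofReal (Real.exp (∑ i, ∑ j, a i j ^ 2))) := by
  have hm : ∀ i, Measurable fun x : Fin d₂ → ℝ => x + a i := fun i => by fun_prop
  have hp : ∀ i, IsProbabilityMeasure ((stdPi (Fin d₂)).map fun x => x + a i) := fun i =>
    Measure.isProbabilityMeasure_map (hm i).aemeasurable
  have h1 := Measure.pi_map_pi (μ := fun _ : Fin d₂ => stdPi (Fin d₂))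
    (f := fun i x => x + a i) (fun i => (hm i).aemeasurable)
  have h2 : (mixLaw d₂).map (fun H => H + a)
      = Measure.pi fun i => (stdPi (Fin d₂)).map fun x => x + a i := h1
  rw [h2, Real.exp_sum, ENNReal.ofReal_prod_of_nonneg fun i _ => (Real.exp_pos _).le]
  exact SqDom.pi fun i => sqDom_stdPi_shift (a i)

theorem continuous_lowerBlock (m : ℕ) :
    Continuous (lowerBlock m : (Fin d₂ → Fin d₂ → ℝ) → Matrix (Fin d₂) (Fin d₂) ℝ) := by
  refine continuous_pi fun j => continuous_pi fun l => ?_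
  simp only [lowerBlock, Matrix.of_apply]
  split_ifs <;> fun_prop

theorem continuous_toSamples_colMix (T : Matrix (Fin d₁) (Fin d₁) ℝ) :
    Continuous fun p : Matrix (Fin d₂) (Fin d₂) ℝ × Noise n d₁ d₂ =>
      toSamples T (colMix p.1 p.2) := by
  refine continuous_pi fun i => ?_
  refine (PiLp.continuous_toLp 2 _).comp (continuous_pi fun q => ?_)
  simp only [Matrix.mulVec, dotProduct, colMix, Finset.sum_apply, Pi.smul_apply, smul_eq_mul]
  refine continuous_finsetSum _ fun b _ => continuous_const.mul
    (continuous_finsetSum _ fun l _ => ?_)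
  exact ((continuous_apply_apply q.2 l).comp continuous_fst).mul (by fun_prop)

theorem measurable_toSamples_colMix (T : Matrix (Fin d₁) (Fin d₁) ℝ)
    (P : Matrix (Fin d₂) (Fin d₂) ℝ) (m : ℕ) (R : ℝ) :
    Measurable fun p : Noise n d₁ d₂ × (Fin d₂ → Fin d₂ → ℝ) =>
      toSamples T (colMix (P + lowerBlock m (R • p.2)) p.1) := by
  have h : Continuous fun p : Noise n d₁ d₂ × (Fin d₂ → Fin d₂ → ℝ) =>
      (P + lowerBlock m (R • p.2), p.1) :=
    (continuous_const.add ((continuous_lowerBlock m).comp (by fun_prop))).prodMk continuous_fst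
  exact ((continuous_toSamples_colMix T).comp h).measurable

theorem measurable_actFirst (m : ℕ) (T : Matrix (Fin d₁) (Fin d₁) ℝ) :
    Measurable (actFirst m T : Noise n d₁ d₂ → Noise n d₁ d₂) := by
  refine Continuous.measurable (continuous_pi fun i => continuous_pi fun j => ?_)
  simp only [actFirst]
  split_ifs <;> fun_prop

/-- The probability, over the random column factor with scale `R`, that the sample built from the
noise `Z` by the row factor `T` and the column factor `P + lowerBlock m (R • H)` lies in `A`. -/
noncomputable def hitProb (A : Set (Samples n d₁ d₂)) (m : ℕ) (P : Matrix (Fin d₂) (Fin d₂) ℝ)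
    (T : Matrix (Fin d₁) (Fin d₁) ℝ) (R : ℝ) (Z : Noise n d₁ d₂) : ℝ≥0∞ :=
  ∫⁻ H, A.indicator 1 (toSamples T (colMix (P + lowerBlock m (R • H)) Z)) ∂(mixLaw d₂)

section

variable {A : Set (Samples n d₁ d₂)} {m : ℕ} {P : Matrix (Fin d₂) (Fin d₂) ℝ}
  {T : Matrix (Fin d₁) (Fin d₁) ℝ} {R : ℝ}

theorem measurable_indicator_sample (hA : MeasurableSet A) :
    Measurable fun p : Noise n d₁ d₂ × (Fin d₂ → Fin d₂ → ℝ) =>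
      A.indicator (1 : Samples n d₁ d₂ → ℝ≥0∞)
        (toSamples T (colMix (P + lowerBlock m (R • p.2)) p.1)) :=
  (measurable_one.indicator hA).comp (measurable_toSamples_colMix T P m R)

theorem measurable_hitProb (hA : MeasurableSet A) : Measurable (hitProb A m P T R) :=
  (measurable_indicator_sample hA).lintegral_prod_right'

theorem hitProb_le_one (Z : Noise n d₁ d₂) : hitProb A m P T R Z ≤ 1 := by
  calc hitProb A m P T R Z ≤ ∫⁻ _, 1 ∂(mixLaw d₂) :=
        lintegral_mono fun H => Set.indicator_le_self' (fun _ _ => zero_le) _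
    _ = 1 := by simp

/-- For a large scale `R` the noise in the last columns is absorbed, up to a factor tending to one,
by the random coefficients. -/
theorem eventually_sq_hitProb_le (hA : MeasurableSet A) {Z : Noise n d₁ d₂}
    (hZ : ∃ S : Fin d₂ → Fin d₂ → ℝ,
      ∀ i j, m ≤ j.val → Z i j = ∑ l, lowerBlock m S j l • Z i l) :
    ∀ᶠ r : ℕ in Filter.atTop,
      hitProb A m 1 T r Z ^ 2 ≤ 2 * hitProb A m (firstProj d₂ m) T r Z := by
  obtain ⟨S, hS⟩ := hZ
  have hlim : Filter.Tendsto (fun r : ℕ => Real.exp (∑ i, ∑ j, (((r : ℝ)⁻¹ • S) i j) ^ 2))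
      Filter.atTop (nhds 1) := by
    have h0 : Filter.Tendsto (fun r : ℕ => ((r : ℝ)⁻¹) ^ 2 * ∑ i, ∑ j, S i j ^ 2)
        Filter.atTop (nhds 0) := by
      have := ((tendsto_inv_atTop_nhds_zero_nat (𝕜 := ℝ)).pow 2).mul_const (∑ i, ∑ j, S i j ^ 2)
      simpa using this
    have h1 := (Real.continuous_exp.tendsto 0).comp h0
    rw [Real.exp_zero] at h1
    refine h1.congr fun r => ?_
    simp [Finset.mul_sum, mul_pow]
  filter_upwards [hlim.eventually (ge_mem_nhds (by norm_num : (1 : ℝ) < 2)),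
    Filter.eventually_gt_atTop 0] with r hr hr0
  have hr0' : (r : ℝ) ≠ 0 := by positivity
  set g : (Fin d₂ → Fin d₂ → ℝ) → ℝ≥0∞ := fun H =>
    A.indicator 1 (toSamples T (colMix (firstProj d₂ m + lowerBlock m ((r : ℝ) • H)) Z)) with hg
  have hgm : Measurable g := by
    have h := (measurable_indicator_sample (P := firstProj d₂ m) (m := m) (T := T) (R := r) hA).comp
      (measurable_prodMk_left (x := Z))
    exact h
  have hgsq : ∀ H, g H ^ 2 = g H := by
    intro H
    by_cases h : toSamples T (colMix (firstProj d₂ m + lowerBlock m ((r : ℝ) • H)) Z) ∈ A <;>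
      simp [hg, h]
  have h1 : hitProb A m 1 T r Z = ∫⁻ H, g H ∂((mixLaw d₂).map fun H => H + (r : ℝ)⁻¹ • S) := by
    rw [lintegral_map hgm (by fun_prop), hitProb]
    refine lintegral_congr fun H => ?_
    rw [colMix_one_add_lowerBlock hS, hg]
    simp only [smul_add, smul_smul, mul_inv_cancel₀ hr0', one_smul]
  rw [h1]
  refine (sqDom_mixLaw_shift _ g hgm).trans ?_
  simp_rw [hgsq]
  have h2 : ENNReal.ofReal (Real.exp (∑ i, ∑ j, (((r : ℝ)⁻¹ • S) i j) ^ 2)) ≤ 2 :=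
    (ENNReal.ofReal_le_ofReal hr).trans (by simp)
  exact mul_le_mul' h2 le_rfl

/-- Replacing `T` by the identity costs only the domination constant of the first `m` columns,
because the noise beyond these columns is not used. -/
theorem sq_lintegral_hitProb_le (hm : m ≤ d₂) {K : ℝ≥0∞}
    (hK : SqDom ((stdPi (Fin d₁)).map T.mulVec) (stdPi (Fin d₁)) K) (hA : MeasurableSet A) :
    (∫⁻ Z, hitProb A m (firstProj d₂ m) T R Z ∂(noiseLaw n d₁ d₂)) ^ 2
      ≤ K ^ (n * m) * ∫⁻ Z, hitProb A m (firstProj d₂ m) 1 R Z ∂(noiseLaw n d₁ d₂) := by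
  have h1 : ∀ Z, hitProb A m (firstProj d₂ m) T R Z
      = hitProb A m (firstProj d₂ m) 1 R (actFirst m T Z) := by
    intro Z
    simp only [hitProb, toSamples_colMix_firstProj m T]
  simp_rw [h1]
  rw [← lintegral_map (measurable_hitProb hA) (measurable_actFirst m T)]
  refine (sqDom_actFirst hm hK _ (measurable_hitProb hA)).trans ?_
  gcongr with Z
  calc hitProb A m (firstProj d₂ m) 1 R Z ^ 2
      ≤ hitProb A m (firstProj d₂ m) 1 R Z ^ 1 :=
        pow_le_pow_right_of_le_one' (hitProb_le_one Z) (by norm_num)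
    _ = _ := pow_one _

theorem lintegral_hitProb_eq (hA : MeasurableSet A) :
    ∫⁻ Z, hitProb A m P T R Z ∂(noiseLaw n d₁ d₂)
      = ((noiseLaw n d₁ d₂).prod (mixLaw d₂)).map (fun p =>
          toSamples T (colMix (P + lowerBlock m (R • p.2)) p.1)) A := by
  rw [← lintegral_indicator_one hA, lintegral_map (measurable_one.indicator hA)
    (measurable_toSamples_colMix T P m R), lintegral_prod _
    (measurable_indicator_sample hA).aemeasurable]
  rfl

theorem exists_law_le_lintegral_hitProb {Θ : Matrix (Fin d₁) (Fin d₁) ℝ} {t : ℝ} (ht : 0 < t)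
    (hT : T * T.transpose = t⁻¹ • Θ⁻¹) (hA : MeasurableSet A) (R : ℝ) :
    ∃ H : Fin d₂ → Fin d₂ → ℝ,
      law n Θ (t • ((1 + lowerBlock m (R • H)) * (1 + lowerBlock m (R • H)).transpose)⁻¹) A
        ≤ ∫⁻ Z, hitProb A m 1 T R Z ∂(noiseLaw n d₁ d₂) := by
  have hm := measurable_indicator_sample (P := 1) (m := m) (T := T) (R := R) hA
  have h1 : ∀ H : Fin d₂ → Fin d₂ → ℝ,
      law n Θ (t • ((1 + lowerBlock m (R • H)) * (1 + lowerBlock m (R • H)).transpose)⁻¹) A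
        = ∫⁻ Z, A.indicator 1 (toSamples T (colMix (1 + lowerBlock m (R • H)) Z))
          ∂(noiseLaw n d₁ d₂) := by
    intro H
    have hXm : Measurable fun Z : Noise n d₁ d₂ =>
        toSamples T (colMix (1 + lowerBlock m (R • H)) Z) := by
      have h := (measurable_toSamples_colMix (n := n) T 1 m R).comp
        (measurable_prodMk_right (y := H))
      exact h
    rw [law_eq_map (det_one_add_lowerBlock m _) ht hT, ← lintegral_indicator_one hA,
      lintegral_map (measurable_one.indicator hA) hXm]
  obtain ⟨H, hH⟩ := exists_le_lintegral (μ := mixLaw d₂)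
    (hm.lintegral_prod_left' (μ := noiseLaw n d₁ d₂)).aemeasurable
  refine ⟨H, ?_⟩
  rw [h1]
  refine hH.trans (le_of_eq ?_)
  simp only [hitProb]
  exact (lintegral_lintegral_swap hm.aemeasurable).symm

end

theorem exists_card_mul_measure_le_one {α κ : Type*} [MeasurableSpace α] [Fintype κ] [Nonempty κ]
    (ν : Measure α) [IsProbabilityMeasure ν] {A : κ → Set α} (hA : ∀ k, MeasurableSet (A k))
    (hd : Pairwise fun k l => Disjoint (A k) (A l)) : ∃ k, Fintype.card κ * ν (A k) ≤ 1 := by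
  obtain ⟨k, hk⟩ := Finite.exists_min fun k => ν (A k)
  refine ⟨k, ?_⟩
  calc Fintype.card κ * ν (A k) = ∑ _l : κ, ν (A k) := by simp
    _ ≤ ∑ l, ν (A l) := Finset.sum_le_sum fun l _ => hk l
    _ ≤ ν Set.univ := sum_measure_le_measure_univ (fun l _ => (hA l).nullMeasurableSet)
        (fun k _ l _ hkl => (hd hkl).aedisjoint)
    _ = 1 := measure_univ

/-- A test with disjoint acceptance regions `A k` fails with probability almost `1/2` for some
precision matrix `Θ k` and some unimodular column factor, provided that the row factors `T k` are
dominated by the identity and that there are enough of them. Only `n * m` columns count, where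
`m = min (n d₁) d₂`. -/
theorem exists_law_le {m : ℕ} (hm : m = d₂ ∨ m = n * d₁ ∧ m ≤ d₂) {κ : Type*} [Fintype κ]
    [Nonempty κ] {Θ T : κ → Matrix (Fin d₁) (Fin d₁) ℝ} {t : κ → ℝ} (ht : ∀ k, 0 < t k)
    (hT : ∀ k, T k * (T k).transpose = (t k)⁻¹ • (Θ k)⁻¹) {K : ℝ≥0∞}
    (hK : ∀ k, SqDom ((stdPi (Fin d₁)).map (T k).mulVec) (stdPi (Fin d₁)) K)
    (hcard : 64 * K ^ (n * m) ≤ Fintype.card κ) {A : κ → Set (Samples n d₁ d₂)}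
    (hA : ∀ k, MeasurableSet (A k)) (hd : Pairwise fun k l => Disjoint (A k) (A l))
    {η : ℝ≥0∞} (hη : 0 < η) :
    ∃ k, ∃ L : Matrix (Fin d₂) (Fin d₂) ℝ, L.det = 1 ∧
      law n (Θ k) (t k • (L * L.transpose)⁻¹) (A k) ≤ 1 / 2 + η := by
  have hmd : m ≤ d₂ := by rcases hm with h | h <;> omega
  set μ := noiseLaw n d₁ d₂ with hμ
  -- `B k r` is the set of noise arrays which the random coefficients do not yet absorb.
  set B : κ → ℕ → Set (Noise n d₁ d₂) := fun k r =>
    {Z | 2 * hitProb (A k) m (firstProj d₂ m) (T k) r Z < hitProb (A k) m 1 (T k) r Z ^ 2} with hB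
  have hBm : ∀ k r, MeasurableSet (B k r) := fun k r =>
    measurableSet_lt ((measurable_hitProb (hA k)).const_mul 2)
      ((measurable_hitProb (hA k)).pow_const 2)
  have hBlim : ∀ k, Filter.Tendsto (fun r => μ (B k r)) Filter.atTop (nhds 0) := by
    intro k
    have := tendsto_measure_of_ae_tendsto_indicator_of_isFiniteMeasure (μ := μ) Filter.atTop
      MeasurableSet.empty (hBm k) (by
        filter_upwards [ae_exists_column_combination hm] with Z hZ
        filter_upwards [eventually_sq_hitProb_le (T := T k) (hA k) hZ] with r hr
        simp only [Set.mem_empty_iff_false, iff_false]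
        exact not_lt.2 hr)
    simpa using this
  obtain ⟨r, hr⟩ : ∃ r : ℕ, ∀ k, μ (B k r) ≤ η :=
    (Filter.eventually_all.2 fun k => (hBlim k).eventually (ge_mem_nhds hη)).exists
  have hpr : IsProbabilityMeasure (((noiseLaw n d₁ d₂).prod (mixLaw d₂)).map (fun p =>
      toSamples 1 (colMix (firstProj d₂ m + lowerBlock m ((r : ℝ) • p.2)) p.1))) :=
    Measure.isProbabilityMeasure_map (measurable_toSamples_colMix _ _ _ _).aemeasurable
  obtain ⟨k, hk⟩ := exists_card_mul_measure_le_one (((noiseLaw n d₁ d₂).prod (mixLaw d₂)).map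
    (fun p => toSamples 1 (colMix (firstProj d₂ m + lowerBlock m ((r : ℝ) • p.2)) p.1))) hA hd
  rw [← lintegral_hitProb_eq (hA k)] at hk
  set p := hitProb (A k) m 1 (T k) r with hp
  set q := hitProb (A k) m (firstProj d₂ m) (T k) r with hq
  have hpm : Measurable p := measurable_hitProb (hA k)
  have hqm : Measurable q := measurable_hitProb (hA k)
  have hq8 : ∫⁻ Z, q Z ∂μ ≤ 1 / 8 := by
    have h1 : (8 * ∫⁻ Z, q Z ∂μ) ^ 2 ≤ 1 ^ 2 := by
      calc (8 * ∫⁻ Z, q Z ∂μ) ^ 2 = 64 * (∫⁻ Z, q Z ∂μ) ^ 2 := by rw [mul_pow]; norm_num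
        _ ≤ 64 * (K ^ (n * m) * ∫⁻ Z, hitProb (A k) m (firstProj d₂ m) 1 r Z ∂μ) := by
            gcongr
            exact sq_lintegral_hitProb_le hmd (hK k) (hA k)
        _ = 64 * K ^ (n * m) * ∫⁻ Z, hitProb (A k) m (firstProj d₂ m) 1 r Z ∂μ := by
            rw [mul_assoc]
        _ ≤ Fintype.card κ * ∫⁻ Z, hitProb (A k) m (firstProj d₂ m) 1 r Z ∂μ := by gcongr
        _ ≤ 1 ^ 2 := by simpa using hk
    have h2 : 8 * ∫⁻ Z, q Z ∂μ ≤ 1 := (ENNReal.pow_right_strictMono two_ne_zero).le_iff_le.1 h1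
    rw [ENNReal.le_div_iff_mul_le (by simp) (by simp), mul_comm]
    exact h2
  have hgood : ∫⁻ Z, (B k r)ᶜ.indicator p Z ∂μ ≤ 1 / 2 := by
    have hsq := SqDom.refl μ _ (hpm.indicator (hBm k r).compl)
    have h1 : (∫⁻ Z, (B k r)ᶜ.indicator p Z ∂μ) ^ 2 ≤ (1 / 2) ^ 2 := by
      calc (∫⁻ Z, (B k r)ᶜ.indicator p Z ∂μ) ^ 2
          ≤ ∫⁻ Z, (B k r)ᶜ.indicator p Z ^ 2 ∂μ := by simpa using hsq
        _ ≤ ∫⁻ Z, 2 * q Z ∂μ := by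
            refine lintegral_mono fun Z => ?_
            by_cases hZ : Z ∈ B k r
            · simp [hZ]
            · rw [Set.indicator_of_mem (Set.mem_compl hZ)]
              exact not_lt.1 hZ
        _ = 2 * ∫⁻ Z, q Z ∂μ := lintegral_const_mul _ hqm
        _ ≤ 2 * (1 / 8) := by gcongr
        _ = (1 / 2) ^ 2 := by
            rw [← ENNReal.toReal_eq_toReal_iff' (by finiteness) (by finiteness)]
            norm_num
    exact (ENNReal.pow_right_strictMono two_ne_zero).le_iff_le.1 h1
  have hptot : ∫⁻ Z, p Z ∂μ ≤ 1 / 2 + η := by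
    calc ∫⁻ Z, p Z ∂μ ≤ ∫⁻ Z, ((B k r)ᶜ.indicator p Z + (B k r).indicator 1 Z) ∂μ := by
          refine lintegral_mono fun Z => ?_
          by_cases hZ : Z ∈ B k r
          · simpa [hZ] using hitProb_le_one Z
          · simp [hZ]
      _ = ∫⁻ Z, (B k r)ᶜ.indicator p Z ∂μ + μ (B k r) := by
          rw [lintegral_add_right _ (measurable_one.indicator (hBm k r)),
            lintegral_indicator_one (hBm k r)]
      _ ≤ 1 / 2 + η := by gcongr; exact hr k
  obtain ⟨H, hH⟩ := exists_law_le_lintegral_hitProb (m := m) (ht k) (hT k) (hA k) r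
  exact ⟨k, 1 + lowerBlock m ((r : ℝ) • H), det_one_add_lowerBlock m _, hH.trans hptot⟩

end MatrixNormal

namespace MatrixNormal

/-! ### Frobenius and operator norms -/

variable {d : ℕ}

theorem frobNorm_eq_norm (M : Matrix (Fin d) (Fin d) ℝ) :
    frobNorm M = ‖(WithLp.toLp 2 fun p : Fin d × Fin d => M p.1 p.2 :
      EuclideanSpace ℝ (Fin d × Fin d))‖ := by
  rw [frobNorm, EuclideanSpace.norm_eq]
  congr 1
  simp only [Matrix.trace, Matrix.diag, Matrix.mul_apply, Matrix.transpose_apply,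
    Fintype.sum_prod_type, Real.norm_eq_abs, sq_abs]
  rw [Finset.sum_comm]
  exact Finset.sum_congr rfl fun i _ => Finset.sum_congr rfl fun j _ => (pow_two _).symm

theorem sq_frobNorm (M : Matrix (Fin d) (Fin d) ℝ) : frobNorm M ^ 2 = ∑ i, ∑ j, M i j ^ 2 := by
  rw [frobNorm_eq_norm, EuclideanSpace.real_norm_sq_eq, Fintype.sum_prod_type]

theorem frobNorm_nonneg (M : Matrix (Fin d) (Fin d) ℝ) : 0 ≤ frobNorm M := Real.sqrt_nonneg _

theorem frobNorm_transpose (M : Matrix (Fin d) (Fin d) ℝ) :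
    frobNorm M.transpose = frobNorm M := by
  rw [← sq_eq_sq₀ (frobNorm_nonneg _) (frobNorm_nonneg _), sq_frobNorm, sq_frobNorm,
    Finset.sum_comm]
  rfl

theorem opNorm_nonneg (M : Matrix (Fin d) (Fin d) ℝ) : 0 ≤ opNorm M := norm_nonneg _

theorem opNorm_transpose (M : Matrix (Fin d) (Fin d) ℝ) : opNorm M.transpose = opNorm M := by
  have h : Matrix.toEuclideanCLM (𝕜 := ℝ) M.transpose
      = star (Matrix.toEuclideanCLM (𝕜 := ℝ) M) := by
    rw [← map_star, Matrix.star_eq_conjTranspose, Matrix.conjTranspose_eq_transpose_of_trivial]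
  rw [opNorm, h]
  exact norm_star (Matrix.toEuclideanCLM (𝕜 := ℝ) M)

theorem opNorm_mul_le (A B : Matrix (Fin d) (Fin d) ℝ) :
    opNorm (A * B) ≤ opNorm A * opNorm B := by
  rw [opNorm, map_mul]; exact norm_mul_le _ _

theorem opNorm_add_le (A B : Matrix (Fin d) (Fin d) ℝ) :
    opNorm (A + B) ≤ opNorm A + opNorm B := by
  rw [opNorm, map_add]; exact norm_add_le _ _

theorem opNorm_neg (A : Matrix (Fin d) (Fin d) ℝ) : opNorm (-A) = opNorm A := by
  rw [opNorm, map_neg, norm_neg, opNorm]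

theorem opNorm_one_le : opNorm (1 : Matrix (Fin d) (Fin d) ℝ) ≤ 1 := by
  rw [opNorm, map_one]; exact ContinuousLinearMap.norm_id_le

theorem sum_mulVec_sq_le (M : Matrix (Fin d) (Fin d) ℝ) (x : Fin d → ℝ) :
    ∑ i, (M.mulVec x i) ^ 2 ≤ opNorm M ^ 2 * ∑ i, x i ^ 2 := by
  have h := ContinuousLinearMap.le_opNorm (Matrix.toEuclideanCLM (𝕜 := ℝ) M) (WithLp.toLp 2 x)
  have h2 := pow_le_pow_left₀ (norm_nonneg _) h 2
  rw [mul_pow, EuclideanSpace.real_norm_sq_eq, EuclideanSpace.real_norm_sq_eq] at h2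
  exact h2

theorem frobNorm_mul_le (A M : Matrix (Fin d) (Fin d) ℝ) :
    frobNorm (A * M) ≤ opNorm A * frobNorm M := by
  rw [← sq_le_sq₀ (frobNorm_nonneg _) (mul_nonneg (opNorm_nonneg _) (frobNorm_nonneg _)), mul_pow,
    sq_frobNorm, sq_frobNorm, Finset.sum_comm, Finset.sum_comm (f := fun i j => M i j ^ 2),
    Finset.mul_sum]
  exact Finset.sum_le_sum fun j _ => sum_mulVec_sq_le A fun i => M i j

theorem opNorm_le_frobNorm (M : Matrix (Fin d) (Fin d) ℝ) : opNorm M ≤ frobNorm M := by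
  refine ContinuousLinearMap.opNorm_le_bound _ (frobNorm_nonneg _) fun x => ?_
  rw [← sq_le_sq₀ (norm_nonneg _) (mul_nonneg (frobNorm_nonneg _) (norm_nonneg _)), mul_pow,
    sq_frobNorm, EuclideanSpace.real_norm_sq_eq, EuclideanSpace.real_norm_sq_eq, Finset.sum_mul]
  refine Finset.sum_le_sum fun i _ => ?_
  exact Finset.sum_mul_sq_le_sq_mul_sq Finset.univ (fun j => M i j) fun j => x.ofLp j

theorem sum_row_sq_le (M : Matrix (Fin d) (Fin d) ℝ) (i : Fin d) :
    ∑ j, M i j ^ 2 ≤ opNorm M ^ 2 := by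
  have h := sum_mulVec_sq_le M.transpose (Pi.single i 1)
  rw [opNorm_transpose] at h
  simpa [Matrix.mulVec_single, Pi.single_apply, ite_pow] using h

/-- The properties shared by the Frobenius and the operator norm that the lower bounds use. -/
structure IsIdealNorm (N : Matrix (Fin d) (Fin d) ℝ → ℝ) : Prop where
  sub_le : ∀ A B, N (A - B) ≤ N A + N B
  mul_mul_le : ∀ C M, N (C * M * C) ≤ opNorm C ^ 2 * N M
  abs_apply_le : ∀ M i j, |M i j| ≤ N M
  continuous : Continuous N

theorem IsIdealNorm.nonneg {N : Matrix (Fin d) (Fin d) ℝ → ℝ} (hN : IsIdealNorm N)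
    (M : Matrix (Fin d) (Fin d) ℝ) : 0 ≤ N M := by
  have h1 := hN.sub_le 0 0
  have h2 := hN.sub_le M M
  rw [sub_self] at h1 h2
  linarith

theorem isIdealNorm_frobNorm : IsIdealNorm (frobNorm : Matrix (Fin d) (Fin d) ℝ → ℝ) where
  sub_le A B := by
    rw [frobNorm_eq_norm, frobNorm_eq_norm, frobNorm_eq_norm]
    exact norm_sub_le (WithLp.toLp 2 fun p : Fin d × Fin d => A p.1 p.2)
      (WithLp.toLp 2 fun p : Fin d × Fin d => B p.1 p.2)
  mul_mul_le C M := by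
    calc frobNorm (C * M * C) = frobNorm (C.transpose * (C * M).transpose) := by
          rw [← Matrix.transpose_mul, frobNorm_transpose]
      _ ≤ opNorm C.transpose * frobNorm (C * M).transpose := frobNorm_mul_le _ _
      _ = opNorm C * frobNorm (C * M) := by rw [opNorm_transpose, frobNorm_transpose]
      _ ≤ opNorm C * (opNorm C * frobNorm M) :=
          mul_le_mul_of_nonneg_left (frobNorm_mul_le _ _) (opNorm_nonneg _)
      _ = opNorm C ^ 2 * frobNorm M := by ring
  abs_apply_le M i j := by
    rw [frobNorm_eq_norm]
    exact PiLp.norm_apply_le (WithLp.toLp 2 fun p : Fin d × Fin d => M p.1 p.2) (i, j)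
  continuous := by
    unfold frobNorm
    exact Real.continuous_sqrt.comp
      ((continuous_id.matrix_transpose.matrix_mul continuous_id).matrix_trace)

theorem isIdealNorm_opNorm : IsIdealNorm (opNorm : Matrix (Fin d) (Fin d) ℝ → ℝ) where
  sub_le A B := by
    rw [opNorm, map_sub]; exact norm_sub_le _ _
  mul_mul_le C M := by
    calc opNorm (C * M * C) ≤ opNorm C * opNorm M * opNorm C :=
          (opNorm_mul_le _ _).trans
            (mul_le_mul_of_nonneg_right (opNorm_mul_le _ _) (opNorm_nonneg _))
      _ = opNorm C ^ 2 * opNorm M := by ring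
  abs_apply_le M i j := by
    refine abs_le_of_sq_le_sq ?_ (opNorm_nonneg _)
    exact (Finset.single_le_sum (f := fun j => M i j ^ 2) (fun j _ => sq_nonneg _)
      (Finset.mem_univ j)).trans (sum_row_sq_le M i)
  continuous := by
    unfold opNorm
    exact continuous_norm.comp
      (LinearMap.continuous_of_finiteDimensional
        (Matrix.toEuclideanCLM (𝕜 := ℝ) (n := Fin d)).toAlgEquiv.toLinearMap)

/-- The relative error bounds the absolute one: `B - A = C (relDiff A B) C` with `C = B^(1/2)`. -/
theorem IsIdealNorm.sub_le_relDiff {N : Matrix (Fin d) (Fin d) ℝ → ℝ} (hN : IsIdealNorm N)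
    {B : Matrix (Fin d) (Fin d) ℝ} (hB : B.PosDef) (A : Matrix (Fin d) (Fin d) ℝ) :
    N (B - A) ≤ opNorm B * N (relDiff A B) := by
  set R := CFC.sqrt B⁻¹ with hR
  have hRR : R * R = B⁻¹ := CFC.sqrt_mul_sqrt_self _ hB.inv.posSemidef.nonneg
  have hBu : IsUnit B.det := hB.isUnit.map Matrix.detMonoidHom
  have hRu : IsUnit R.det := by
    have h : R.det * R.det = B⁻¹.det := by rw [← Matrix.det_mul, hRR]
    have h2 : IsUnit (R.det * R.det) := by
      rw [h]; exact hB.inv.isUnit.map Matrix.detMonoidHom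
    exact isUnit_of_mul_isUnit_left h2
  have hRt : R.transpose = R := by
    have : star R = R := (CFC.sqrt_nonneg B⁻¹).isSelfAdjoint
    rwa [Matrix.star_eq_conjTranspose, Matrix.conjTranspose_eq_transpose_of_trivial] at this
  have hCC : R⁻¹ * R⁻¹ = B := by
    rw [← Matrix.mul_inv_rev, hRR, Matrix.nonsing_inv_nonsing_inv _ hBu]
  have hCt : R⁻¹.transpose = R⁻¹ := by rw [Matrix.transpose_nonsing_inv, hRt]
  have hop : opNorm R⁻¹ ^ 2 = opNorm B := by
    have h : star (Matrix.toEuclideanCLM (𝕜 := ℝ) R⁻¹) = Matrix.toEuclideanCLM (𝕜 := ℝ) R⁻¹ := by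
      rw [← map_star, Matrix.star_eq_conjTranspose, Matrix.conjTranspose_eq_transpose_of_trivial,
        hCt]
    have h2 := CStarRing.norm_star_mul_self (x := Matrix.toEuclideanCLM (𝕜 := ℝ) R⁻¹)
    rw [h, ← map_mul, hCC] at h2
    rw [pow_two]
    exact h2.symm
  have key : R⁻¹ * relDiff A B * R⁻¹ = B - A := by
    rw [relDiff, ← hR, Matrix.mul_sub, Matrix.sub_mul, Matrix.mul_one, hCC]
    congr 1
    calc R⁻¹ * (R * A * R) * R⁻¹ = (R⁻¹ * R) * A * (R * R⁻¹) := by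
          simp only [Matrix.mul_assoc]
      _ = A := by
          rw [Matrix.nonsing_inv_mul _ hRu, Matrix.mul_nonsing_inv _ hRu, Matrix.one_mul,
            Matrix.mul_one]
  rw [← key, ← hop]
  exact hN.mul_mul_le _ _

theorem IsEstimator.measurable_relDiff {N : Matrix (Fin d) (Fin d) ℝ → ℝ} (hN : IsIdealNorm N)
    {n d₂ : ℕ} {est : Samples n d d₂ → Matrix (Fin d) (Fin d) ℝ} (hest : IsEstimator est)
    (B : Matrix (Fin d) (Fin d) ℝ) : Measurable fun x => N (relDiff (est x) B) := by
  have h1 : Continuous fun f : Fin d → Fin d → ℝ => N (relDiff (Matrix.of f) B) := by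
    refine hN.continuous.comp ?_
    unfold relDiff
    exact continuous_const.sub ((continuous_const.matrix_mul continuous_id).matrix_mul
      continuous_const)
  exact h1.measurable.comp (measurable_pi_lambda _ fun i => measurable_pi_lambda _ fun j =>
    hest i j)

/-! ### From testing to estimation -/

theorem half_le_iSup_of_separated {n d₁ d₂ m : ℕ} (hd₂ : 0 < d₂)
    (hm : m = d₂ ∨ m = n * d₁ ∧ m ≤ d₂) {κ : Type*} [Fintype κ] [Nonempty κ]
    {N : Matrix (Fin d₁) (Fin d₁) ℝ → ℝ} (hN : IsIdealNorm N)
    {Θ T : κ → Matrix (Fin d₁) (Fin d₁) ℝ} {t : κ → ℝ} (hΘ : ∀ k, (Θ k).PosDef)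
    (hball : ∀ k, opNorm (Θ k - 1) < 1 / 2) (ht : ∀ k, 0 < t k)
    (hdet : ∀ k, (Θ k).det ^ (1 / (d₁ : ℝ)) = t k)
    (hT : ∀ k, T k * (T k).transpose = (t k)⁻¹ • (Θ k)⁻¹) {K : ℝ≥0∞}
    (hK : ∀ k, SqDom ((stdPi (Fin d₁)).map (T k).mulVec) (stdPi (Fin d₁)) K)
    (hcard : 64 * K ^ (n * m) ≤ Fintype.card κ) {δ : ℝ}
    (hsep : ∀ k l, k ≠ l → 3 * δ ≤ N (Θ k - Θ l))
    {est : Samples n d₁ d₂ → Matrix (Fin d₁) (Fin d₁) ℝ} (hest : IsEstimator est)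
    {S : Set (Matrix (Fin d₁) (Fin d₁) ℝ × Matrix (Fin d₂) (Fin d₂) ℝ)}
    (hS : S = params d₁ d₂ ∨ S = normalizedParams d₁ d₂) :
    (1 / 2 : ℝ≥0∞) ≤ ⨆ θ ∈ S, law n θ.1 θ.2 {x | δ ≤ N (relDiff (est x) θ.1)} := by
  set A : κ → Set (Samples n d₁ d₂) := fun k => {x | N (relDiff (est x) (Θ k)) < δ} with hA
  have hAm : ∀ k, MeasurableSet (A k) := fun k =>
    measurableSet_lt (hest.measurable_relDiff hN (Θ k)) measurable_const
  have hclose : ∀ k, ∀ x ∈ A k, N (Θ k - est x) < 3 / 2 * δ := by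
    intro k x hx
    have h1 := hN.sub_le_relDiff (hΘ k) (est x)
    have h2 : opNorm (Θ k) ≤ 3 / 2 := by
      have := opNorm_add_le (Θ k - 1) 1
      rw [sub_add_cancel] at this
      linarith [hball k, opNorm_one_le (d := d₁)]
    have h3 : N (relDiff (est x) (Θ k)) < δ := hx
    nlinarith [hN.nonneg (relDiff (est x) (Θ k))]
  have hd : Pairwise fun k l => Disjoint (A k) (A l) := by
    intro k l hkl
    refine Set.disjoint_left.2 fun x hk hl => ?_
    have h1 := hN.sub_le (Θ k - est x) (Θ l - est x)
    rw [sub_sub_sub_cancel_right] at h1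
    linarith [hsep k l hkl, hclose k x hk, hclose l x hl]
  refine ENNReal.le_of_forall_pos_le_add fun η hη _ => ?_
  obtain ⟨k, L, hL, hlaw⟩ := exists_law_le hm ht hT hK hcard hAm hd
    (η := (η : ℝ≥0∞)) (by exact_mod_cast hη)
  have hLu : IsUnit L.det := by rw [hL]; exact isUnit_one
  have hpd : (t k • (L * L.transpose)⁻¹).PosDef := by
    refine Matrix.PosDef.smul (Matrix.PosDef.inv ?_) (ht k)
    have := Matrix.PosDef.mul_conjTranspose_self L
      (Matrix.vecMul_injective_of_isUnit ((Matrix.isUnit_iff_isUnit_det L).2 hLu))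
    rwa [Matrix.conjTranspose_eq_transpose_of_trivial] at this
  have hnorm : (Θ k, t k • (L * L.transpose)⁻¹) ∈ normalizedParams d₁ d₂ := by
    refine ⟨⟨hΘ k, hball k, hpd⟩, ?_⟩
    simp only
    rw [hdet k, Matrix.det_smul, Matrix.det_nonsing_inv, Matrix.det_mul, Matrix.det_transpose, hL,
      Fintype.card_fin]
    simp only [mul_one, Ring.inverse_one]
    rw [one_div, Real.pow_rpow_inv_natCast (ht k).le hd₂.ne']
  have hmem : (Θ k, t k • (L * L.transpose)⁻¹) ∈ S := by
    rcases hS with rfl | rfl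
    · exact hnorm.1
    · exact hnorm
  have hprob : IsProbabilityMeasure (law n (Θ k) (t k • (L * L.transpose)⁻¹)) := by
    unfold law; infer_instance
  have hcompl : law n (Θ k) (t k • (L * L.transpose)⁻¹) {x | δ ≤ N (relDiff (est x) (Θ k))}
      = 1 - law n (Θ k) (t k • (L * L.transpose)⁻¹) (A k) := by
    rw [← prob_compl_eq_one_sub (hAm k)]
    congr 1
    ext x
    simp [hA]
  have hge : (1 / 2 : ℝ≥0∞) ≤
      law n (Θ k) (t k • (L * L.transpose)⁻¹) {x | δ ≤ N (relDiff (est x) (Θ k))} + η := by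
    rw [hcompl]
    have h1 : (1 : ℝ≥0∞) ≤ 1 - law n (Θ k) (t k • (L * L.transpose)⁻¹) (A k) + (1 / 2 + η) :=
      (le_tsub_add).trans (by gcongr)
    have h2 : (1 / 2 : ℝ≥0∞) + 1 / 2
        ≤ 1 / 2 + (1 - law n (Θ k) (t k • (L * L.transpose)⁻¹) (A k) + η) := by
      rw [ENNReal.add_halves]
      refine h1.trans (le_of_eq ?_)
      ring
    exact (ENNReal.add_le_add_iff_left (by simp)).1 h2
  exact hge.trans (by gcongr; exact le_iSup₂_of_le _ hmem le_rfl)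

end MatrixNormal

namespace MatrixNormal

/-! ### Packing a Euclidean ball -/

/-- A ball of radius `r` contains at least `128 ^ dim` points at mutual distance more than `r / 128`:
fewer balls of radius `r / 128` cannot cover it, by volume. -/
theorem exists_separated_finset {E : Type*} [NormedAddCommGroup E] [InnerProductSpace ℝ E]
    [FiniteDimensional ℝ E] [MeasurableSpace E] [BorelSpace E] {r : ℝ} (hr : 0 < r) :
    ∃ s : Finset E, s.card = 128 ^ Module.finrank ℝ E ∧ (∀ x ∈ s, ‖x‖ ≤ r) ∧
      ∀ x ∈ s, ∀ y ∈ s, x ≠ y → r / 128 < ‖x - y‖ := by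
  suffices h : ∀ k ≤ 128 ^ Module.finrank ℝ E, ∃ s : Finset E, s.card = k ∧ (∀ x ∈ s, ‖x‖ ≤ r) ∧
      ∀ x ∈ s, ∀ y ∈ s, x ≠ y → r / 128 < ‖x - y‖ from h _ le_rfl
  intro k
  induction k with
  | zero => exact fun _ => ⟨∅, by simp⟩
  | succ k ih =>
    intro hk
    obtain ⟨s, hcard, hs, hsep⟩ := ih (by omega)
    obtain ⟨z, hz, hzs⟩ : ∃ z ∈ Metric.closedBall (0 : E) r,
        z ∉ ⋃ x ∈ s, Metric.closedBall x (1 / 128 * r) := by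
      by_contra! hcon
      set v := (volume : Measure E) (Metric.closedBall (0 : E) r) with hv
      have hv0 : v ≠ 0 := (Metric.measure_closedBall_pos _ _ hr).ne'
      have hvt : v ≠ ⊤ := measure_closedBall_lt_top.ne
      have h1 : v ≤ k * (ENNReal.ofReal ((1 / 128) ^ Module.finrank ℝ E) * v) := by
        calc v ≤ (volume : Measure E) (⋃ x ∈ s, Metric.closedBall x (1 / 128 * r)) :=
              measure_mono hcon
          _ ≤ ∑ x ∈ s, (volume : Measure E) (Metric.closedBall x (1 / 128 * r)) :=
              measure_biUnion_finset_le _ _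
          _ = ∑ _x ∈ s, ENNReal.ofReal ((1 / 128) ^ Module.finrank ℝ E) * v :=
              Finset.sum_congr rfl fun x _ =>
                Measure.addHaar_closedBall_mul volume x (by norm_num) hr.le
          _ = k * (ENNReal.ofReal ((1 / 128) ^ Module.finrank ℝ E) * v) := by
              rw [Finset.sum_const, hcard, nsmul_eq_mul]
      have h2 : (k : ℝ≥0∞) * ENNReal.ofReal ((1 / 128) ^ Module.finrank ℝ E) < 1 := by
        rw [← ENNReal.ofReal_natCast, ← ENNReal.ofReal_mul (by positivity), ← ENNReal.ofReal_one,
          ENNReal.ofReal_lt_ofReal_iff one_pos, one_div, inv_pow, ← div_eq_mul_inv,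
          div_lt_one (by positivity)]
        exact_mod_cast Nat.lt_of_succ_le hk
      rw [← mul_assoc] at h1
      have h3 := ENNReal.mul_lt_mul_left hv0 hvt h2
      rw [one_mul] at h3
      exact absurd h1 (not_le.2 h3)
    simp only [Set.mem_iUnion, not_exists, Metric.mem_closedBall, not_le, dist_eq_norm] at hzs
    have hzs' : ∀ x ∈ s, r / 128 < ‖z - x‖ := fun x hx => by
      have := hzs x hx; rwa [one_div_mul_eq_div] at this
    have hznot : z ∉ s := by
      intro hmem
      have := hzs' z hmem
      rw [sub_self, norm_zero] at this
      linarith [div_pos hr (by norm_num : (0 : ℝ) < 128)]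
    classical
    refine ⟨insert z s, by rw [Finset.card_insert_of_notMem hznot, hcard], ?_, ?_⟩
    · intro x hx
      rcases Finset.mem_insert.1 hx with rfl | hx
      · simpa using hz
      · exact hs x hx
    · intro x hx y hy hxy
      rcases Finset.mem_insert.1 hx with hxz | hxs <;> rcases Finset.mem_insert.1 hy with hyz | hys
      · exact absurd (hxz.trans hyz.symm) hxy
      · rw [hxz]; exact hzs' y hys
      · rw [hyz, norm_sub_rev]; exact hzs' x hxs
      · exact hsep x hxs y hys hxy

/-! ### Unipotent row factors -/

variable {d : ℕ}

/-- The positions `(i, j)` with `i < p ≤ j`, that is, the upper right `p × (d - p)` block. -/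
abbrev Block (d p : ℕ) : Type :=
  {q : Fin d × Fin d // q.1.val < p ∧ p ≤ q.2.val}

theorem card_block {p : ℕ} (hp : p ≤ d) : Fintype.card (Block d p) = p * (d - p) := by
  have e := Fintype.card_congr
    (Equiv.subtypeProdEquivProd (p := fun i : Fin d => i.val < p) (q := fun j : Fin d => p ≤ j.val))
  rw [e, Fintype.card_prod, Fintype.card_subtype, Fintype.card_subtype, Fin.card_filter_val_lt,
    min_eq_right hp]
  congr 1
  have := Finset.card_filter_add_card_filter_not (s := (Finset.univ : Finset (Fin d)))
    (fun j : Fin d => j.val < p)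
  rw [Fin.card_filter_val_lt, min_eq_right hp, Finset.card_univ, Fintype.card_fin] at this
  simp only [not_lt] at this
  omega

/-- The strictly upper triangular matrix with the given upper right block. -/
def blockMatrix {p : ℕ} (v : EuclideanSpace ℝ (Block d p)) : Matrix (Fin d) (Fin d) ℝ :=
  Matrix.of fun i j => if h : i.val < p ∧ p ≤ j.val then v ⟨(i, j), h⟩ else 0

section Block

variable {p : ℕ} (v w : EuclideanSpace ℝ (Block d p))

theorem blockMatrix_apply (q : Block d p) : blockMatrix v q.1.1 q.1.2 = v q := by
  simp only [blockMatrix, Matrix.of_apply]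
  rw [dif_pos q.2]

theorem blockMatrix_mul_self : blockMatrix v * blockMatrix v = 0 := by
  ext i j
  simp only [Matrix.mul_apply, blockMatrix, Matrix.of_apply, Matrix.zero_apply]
  refine Finset.sum_eq_zero fun l _ => ?_
  by_cases h : l.val < p
  · rw [dif_neg (by omega), zero_mul]
  · rw [dif_neg (c := l.val < p ∧ p ≤ j.val) (by omega), mul_zero]

theorem sum_sq_blockMatrix : ∑ i, ∑ j, blockMatrix v i j ^ 2 = ‖v‖ ^ 2 := by
  rw [EuclideanSpace.real_norm_sq_eq, ← Fintype.sum_prod_type' fun i j => blockMatrix v i j ^ 2]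
  symm
  refine Finset.sum_of_injOn (fun q : Block d p => q.1) (fun a _ b _ h => Subtype.ext h)
    (fun q _ => Finset.mem_coe.2 (Finset.mem_univ _)) ?_ ?_
  · intro q _ hq
    have : ¬ (q.1.val < p ∧ p ≤ q.2.val) := fun h =>
      hq ⟨⟨q, h⟩, Finset.mem_coe.2 (Finset.mem_univ _), rfl⟩
    simp [blockMatrix, this]
  · intro q _
    rw [blockMatrix_apply]

/-- The precision matrix of the column covariance `(1 + M)(1 + M)ᵀ`, where `M = blockMatrix v`.
Its determinant is one for every `v`. -/
def blockPrecision : Matrix (Fin d) (Fin d) ℝ :=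
  (1 - blockMatrix v).transpose * (1 - blockMatrix v)

theorem one_sub_mul_one_add_blockMatrix : (1 - blockMatrix v) * (1 + blockMatrix v) = 1 := by
  rw [sub_mul, mul_add, mul_add, blockMatrix_mul_self]
  simp

theorem det_one_sub_blockMatrix : (1 - blockMatrix v).det = 1 := by
  have h : -blockMatrix v * -blockMatrix v = 0 := by rw [neg_mul_neg, blockMatrix_mul_self]
  rw [sub_eq_add_neg, det_one_add_of_sq_eq_zero h]

theorem det_blockPrecision : (blockPrecision v).det = 1 := by
  rw [blockPrecision, Matrix.det_mul, Matrix.det_transpose, det_one_sub_blockMatrix, one_mul]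

theorem posDef_blockPrecision : (blockPrecision v).PosDef := by
  have h := Matrix.PosDef.conjTranspose_mul_self (1 - blockMatrix v)
    (Matrix.mulVec_injective_of_isUnit ((Matrix.isUnit_iff_isUnit_det _).2 (by
      rw [det_one_sub_blockMatrix]; exact isUnit_one)))
  rwa [Matrix.conjTranspose_eq_transpose_of_trivial] at h

theorem inv_blockPrecision :
    (blockPrecision v)⁻¹ = (1 + blockMatrix v) * (1 + blockMatrix v).transpose := by
  have h : (1 - blockMatrix v)⁻¹ = 1 + blockMatrix v :=
    Matrix.inv_eq_right_inv (one_sub_mul_one_add_blockMatrix v)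
  rw [blockPrecision, Matrix.mul_inv_rev, ← Matrix.transpose_nonsing_inv, h]

theorem opNorm_blockPrecision_sub_one_lt (hv : ‖v‖ ≤ 1 / 5) :
    opNorm (blockPrecision v - 1) < 1 / 2 := by
  have hb : opNorm (blockMatrix v) ≤ 1 / 5 := by
    refine (opNorm_le_frobNorm _).trans (le_trans (le_of_eq ?_) hv)
    rw [← sq_eq_sq₀ (frobNorm_nonneg _) (norm_nonneg _), sq_frobNorm, sum_sq_blockMatrix]
  have h0 := opNorm_nonneg (blockMatrix v)
  have e : blockPrecision v - 1 = (blockMatrix v).transpose * blockMatrix v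
      + -(blockMatrix v + (blockMatrix v).transpose) := by
    rw [blockPrecision, Matrix.transpose_sub, Matrix.transpose_one, sub_mul, mul_sub, mul_sub]
    simp only [mul_one, one_mul]
    abel
  have h1 := opNorm_add_le ((blockMatrix v).transpose * blockMatrix v)
    (-(blockMatrix v + (blockMatrix v).transpose))
  have h2 := opNorm_mul_le (blockMatrix v).transpose (blockMatrix v)
  have h3 := opNorm_add_le (blockMatrix v) (blockMatrix v).transpose
  rw [opNorm_neg] at h1
  rw [opNorm_transpose] at h2 h3
  rw [e]
  nlinarith

/-- On the upper right block the precision matrix is affine in `v`. -/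
theorem blockPrecision_apply (q : Block d p) : blockPrecision v q.1.1 q.1.2 = -v q := by
  obtain ⟨⟨i, j⟩, hi, hj⟩ := q
  have h1 : ((blockMatrix v).transpose * blockMatrix v) i j = 0 := by
    rw [Matrix.mul_apply]
    refine Finset.sum_eq_zero fun l _ => ?_
    simp only [Matrix.transpose_apply, blockMatrix, Matrix.of_apply]
    simp only at hi hj
    rw [dif_neg (by omega), zero_mul]
  have h2 : (blockMatrix v).transpose i j = 0 := by
    simp only [Matrix.transpose_apply, blockMatrix, Matrix.of_apply]
    simp only at hi hj
    rw [dif_neg (by omega)]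
  have h3 : (1 : Matrix (Fin d) (Fin d) ℝ) i j = 0 := by
    refine Matrix.one_apply_ne ?_
    rintro rfl
    simp only at hi hj
    omega
  have h4 := blockMatrix_apply v ⟨(i, j), hi, hj⟩
  rw [blockPrecision, Matrix.transpose_sub, Matrix.transpose_one, sub_mul, mul_sub, mul_sub]
  simp only [mul_one, one_mul, Matrix.sub_apply, h1, h2, h3]
  simp only at h4 ⊢
  rw [h4]
  ring

theorem norm_sub_le_frobNorm : ‖v - w‖ ≤ frobNorm (blockPrecision v - blockPrecision w) := by
  rw [← sq_le_sq₀ (norm_nonneg _) (frobNorm_nonneg _), sq_frobNorm,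
    EuclideanSpace.real_norm_sq_eq, ← Fintype.sum_prod_type'
      fun i j => (blockPrecision v - blockPrecision w) i j ^ 2]
  let F : Fin d × Fin d → ℝ := fun r => (blockPrecision v - blockPrecision w) r.1 r.2 ^ 2
  have : ∀ q : Block d p, (v - w) q ^ 2
      = F q.1 := by
    intro q
    simp only [F, Matrix.sub_apply, blockPrecision_apply, PiLp.sub_apply]
    ring
  simp_rw [this]
  rw [← Finset.sum_image (s := Finset.univ) (g := fun q : Block d p => q.1) (f := F)
    (fun a _ b _ h => Subtype.ext h)]
  exact Finset.sum_le_sum_of_subset_of_nonneg (Finset.subset_univ _) fun _ _ _ => sq_nonneg _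

end Block

/-- For `p = 1` the block is a single row, whose Euclidean norm is at most the operator norm. -/
theorem norm_sub_le_opNorm (hd : 0 < d) (v w : EuclideanSpace ℝ (Block d 1)) :
    ‖v - w‖ ≤ opNorm (blockPrecision v - blockPrecision w) := by
  rw [← sq_le_sq₀ (norm_nonneg _) (opNorm_nonneg _), EuclideanSpace.real_norm_sq_eq]
  refine le_trans ?_ (sum_row_sq_le (blockPrecision v - blockPrecision w) ⟨0, hd⟩)
  have hq0 : ∀ q : Block d 1, q.1.1 = ⟨0, hd⟩ := fun q =>
    Fin.ext (by have := q.2.1; simp only; omega)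
  have : ∀ q : Block d 1, (v - w) q ^ 2
      = (fun j => (blockPrecision v - blockPrecision w) ⟨0, hd⟩ j ^ 2) q.1.2 := by
    intro q
    simp only
    rw [← hq0 q, Matrix.sub_apply, blockPrecision_apply, blockPrecision_apply, PiLp.sub_apply]
    ring
  simp_rw [this]
  rw [← Finset.sum_image (s := Finset.univ) (g := fun q : Block d 1 => q.1.2)
    (f := fun j => (blockPrecision v - blockPrecision w) ⟨0, hd⟩ j ^ 2)
    (fun a _ b _ h => Subtype.ext (Prod.ext ((hq0 a).trans (hq0 b).symm) h))]
  exact Finset.sum_le_sum_of_subset_of_nonneg (Finset.subset_univ _) fun _ _ _ => sq_nonneg _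

theorem sqDom_one_add_blockMatrix {p : ℕ} {v : EuclideanSpace ℝ (Block d p)} {r : ℝ}
    (hv : ‖v‖ ≤ r) (hr : r ≤ 1 / 5) :
    SqDom ((stdPi (Fin d)).map (1 + blockMatrix v).mulVec) (stdPi (Fin d))
      (ENNReal.ofReal (Real.exp (2 * r ^ 2))) := by
  have h := sqDom_stdPi_shear (blockMatrix_mul_self v)
  have e : (1 + blockMatrix v).mulVec = fun x => x + (blockMatrix v).mulVec x := by
    ext1 x
    rw [Matrix.add_mulVec, Matrix.one_mulVec]
  have hsq : ‖v‖ ^ 2 ≤ r ^ 2 := pow_le_pow_left₀ (norm_nonneg _) hv 2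
  have hr2 : r ^ 2 ≤ 1 / 25 := by
    have := pow_le_pow_left₀ ((norm_nonneg _).trans hv) hr 2
    norm_num at this ⊢
    exact this
  rw [e]
  refine h.mono ((lintegral_exp_mulVec_sq_le _ ?_).trans (ENNReal.ofReal_le_ofReal ?_))
  · rw [sum_sq_blockMatrix]; linarith
  · rw [sum_sq_blockMatrix]
    exact Real.exp_le_exp.2 (by linarith)

/-! ### The lower bounds in terms of the radius -/

theorem half_le_iSup_of_block {n d₁ d₂ m p : ℕ} (hd₂ : 0 < d₂)
    (hm : m = d₂ ∨ m = n * d₁ ∧ m ≤ d₂) (hp : 0 < p) (hpd : p < d₁)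
    {N : Matrix (Fin d₁) (Fin d₁) ℝ → ℝ} (hN : IsIdealNorm N)
    (hsep : ∀ v w : EuclideanSpace ℝ (Block d₁ p),
      ‖v - w‖ ≤ N (blockPrecision v - blockPrecision w))
    {δ : ℝ} (hδ : 0 < δ) (hδ5 : 384 * δ ≤ 1 / 5)
    (hrate : 2 * (384 * δ) ^ 2 * (n * m) ≤ (p * (d₁ - p) : ℕ) * Real.log 2)
    {est : Samples n d₁ d₂ → Matrix (Fin d₁) (Fin d₁) ℝ} (hest : IsEstimator est)
    {S : Set (Matrix (Fin d₁) (Fin d₁) ℝ × Matrix (Fin d₂) (Fin d₂) ℝ)}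
    (hS : S = params d₁ d₂ ∨ S = normalizedParams d₁ d₂) :
    (1 / 2 : ℝ≥0∞) ≤ ⨆ θ ∈ S, law n θ.1 θ.2 {x | δ ≤ N (relDiff (est x) θ.1)} := by
  obtain ⟨s, hcard, hs, hss⟩ :=
    exists_separated_finset (E := EuclideanSpace ℝ (Block d₁ p)) (r := 384 * δ) (by linarith)
  rw [finrank_euclideanSpace, card_block hpd.le] at hcard
  set D := p * (d₁ - p) with hD
  have hD1 : 1 ≤ D := Nat.mul_pos hp (by omega)
  have hne : Nonempty s := by
    rw [← Fintype.card_pos_iff, Fintype.card_coe, hcard]; positivity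
  refine half_le_iSup_of_separated (κ := s) (Θ := fun v => blockPrecision v.1)
    (T := fun v => 1 + blockMatrix v.1) (t := fun _ => 1)
    (K := ENNReal.ofReal (Real.exp (2 * (384 * δ) ^ 2))) hd₂ hm hN
    (fun v => posDef_blockPrecision _)
    (fun v => opNorm_blockPrecision_sub_one_lt _ ((hs v.1 v.2).trans hδ5)) (fun _ => one_pos)
    (fun v => by rw [det_blockPrecision, Real.one_rpow])
    (fun v => by rw [inv_blockPrecision, inv_one, one_smul])
    (fun v => sqDom_one_add_blockMatrix (hs v.1 v.2) hδ5) ?_ ?_ hest hS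
  · rw [Fintype.card_coe, hcard, ← ENNReal.ofReal_pow (Real.exp_pos _).le, ← Real.exp_nat_mul]
    have h1 : Real.exp (((n * m : ℕ) : ℝ) * (2 * (384 * δ) ^ 2)) ≤ 2 ^ D := by
      calc Real.exp (((n * m : ℕ) : ℝ) * (2 * (384 * δ) ^ 2)) ≤ Real.exp (D * Real.log 2) := by
            apply Real.exp_le_exp.2
            push_cast at hrate ⊢
            linarith
        _ = 2 ^ D := by rw [Real.exp_nat_mul, Real.exp_log two_pos]
    calc 64 * ENNReal.ofReal (Real.exp (((n * m : ℕ) : ℝ) * (2 * (384 * δ) ^ 2)))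
        ≤ 64 ^ D * ENNReal.ofReal (2 ^ D) := by
          gcongr
          exact le_self_pow₀ (by norm_num) (by omega)
      _ = ((128 ^ D : ℕ) : ℝ≥0∞) := by
          rw [ENNReal.ofReal_pow (by norm_num), ← mul_pow]
          push_cast
          congr 1
          norm_num
  · intro v w hvw
    have h1 := hss v.1 v.2 w.1 w.2 fun h => hvw (Subtype.ext h)
    linarith [hsep v.1 w.1]

theorem half_le_iSup_of_scalar {n d₂ m : ℕ} (hd₂ : 0 < d₂) (hm : m = d₂ ∨ m = n * 1 ∧ m ≤ d₂)
    {N : Matrix (Fin 1) (Fin 1) ℝ → ℝ} (hN : IsIdealNorm N) {δ : ℝ} (hδ : 0 < δ)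
    (hδ5 : 384 * δ ≤ 1 / 5) (hrate : 5 * (384 * δ) ^ 2 * (n * m) ≤ Real.log 2)
    {est : Samples n 1 d₂ → Matrix (Fin 1) (Fin 1) ℝ} (hest : IsEstimator est)
    {S : Set (Matrix (Fin 1) (Fin 1) ℝ × Matrix (Fin d₂) (Fin d₂) ℝ)}
    (hS : S = params 1 d₂ ∨ S = normalizedParams 1 d₂) :
    (1 / 2 : ℝ≥0∞) ≤ ⨆ θ ∈ S, law n θ.1 θ.2 {x | δ ≤ N (relDiff (est x) θ.1)} := by
  set a : Fin 128 → ℝ := fun k => 1 + k.val * (3 * δ) with ha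
  have ha1 : ∀ k, 1 ≤ a k := fun k => by simp only [ha]; nlinarith [k.val.cast_nonneg (α := ℝ)]
  have ha2 : ∀ k, a k ≤ 1 + 384 * δ := by
    intro k
    have : (k.val : ℝ) ≤ 128 := by exact_mod_cast k.isLt.le
    simp only [ha]; nlinarith
  have ha0 : ∀ k, 0 < a k := fun k => by linarith [ha1 k]
  refine half_le_iSup_of_separated (κ := Fin 128) (Θ := fun k => Matrix.diagonal fun _ => a k)
    (T := fun k => Matrix.diagonal fun _ => (a k)⁻¹) (t := a)
    (K := ENNReal.ofReal (Real.exp (5 * (384 * δ) ^ 2))) hd₂ hm hN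
    (fun k => Matrix.PosDef.diagonal fun _ => ha0 k) ?_ ha0 ?_ ?_ ?_ ?_ ?_ hest hS
  · intro k
    refine lt_of_le_of_lt (opNorm_le_frobNorm _) ?_
    have hsq : frobNorm ((Matrix.diagonal fun _ => a k : Matrix (Fin 1) (Fin 1) ℝ) - 1) ^ 2
        = (a k - 1) ^ 2 := by
      rw [sq_frobNorm]; simp
    rw [sq_eq_sq₀ (frobNorm_nonneg _) (by linarith [ha1 k])] at hsq
    rw [hsq]
    linarith [ha2 k]
  · intro k
    simp
  · intro k
    have hinv : (Matrix.diagonal fun _ => a k : Matrix (Fin 1) (Fin 1) ℝ)⁻¹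
        = Matrix.diagonal fun _ => (a k)⁻¹ := by
      refine Matrix.inv_eq_right_inv ?_
      rw [Matrix.diagonal_mul_diagonal]
      simp [mul_inv_cancel₀ (ha0 k).ne']
    rw [hinv, Matrix.diagonal_transpose, Matrix.diagonal_mul_diagonal]
    ext i j
    simp [Matrix.diagonal_apply]
  · intro k
    have hmap : (stdPi (Fin 1)).map (Matrix.diagonal fun _ : Fin 1 => (a k)⁻¹).mulVec
        = Measure.pi fun _ : Fin 1 => (gaussianReal 0 1).map fun x => (a k)⁻¹ * x := by
      have hp : IsProbabilityMeasure ((gaussianReal 0 1).map fun x => (a k)⁻¹ * x) :=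
        Measure.isProbabilityMeasure_map (by fun_prop)
      rw [← Measure.pi_map_pi fun _ => by fun_prop]
      congr 1
      ext x i
      rw [Matrix.mulVec_diagonal]
    have hp : IsProbabilityMeasure ((gaussianReal 0 1).map fun x => (a k)⁻¹ * x) :=
      Measure.isProbabilityMeasure_map (by fun_prop)
    rw [hmap]
    refine (SqDom.pi fun _ : Fin 1 => sqDom_gaussianReal_scale (ha1 k)).mono ?_
    rw [Fin.prod_univ_one]
    refine ENNReal.ofReal_le_ofReal (Real.exp_le_exp.2 ?_)
    have h1 := ha1 k
    have h2 := ha2 k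
    have h3 : a k ^ 2 - 1 ≤ 11 / 5 * (384 * δ) := by nlinarith
    have h4 : 0 ≤ a k ^ 2 - 1 := by nlinarith
    nlinarith [pow_le_pow_left₀ h4 h3 2, sq_nonneg (384 * δ)]
  · rw [← ENNReal.ofReal_pow (Real.exp_pos _).le, ← Real.exp_nat_mul, Fintype.card_fin]
    have h1 : Real.exp (((n * m : ℕ) : ℝ) * (5 * (384 * δ) ^ 2)) ≤ 2 := by
      calc _ ≤ Real.exp (Real.log 2) := by
            apply Real.exp_le_exp.2
            push_cast
            linarith
        _ = 2 := Real.exp_log two_pos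
    calc 64 * ENNReal.ofReal (Real.exp (((n * m : ℕ) : ℝ) * (5 * (384 * δ) ^ 2)))
        ≤ 64 * ENNReal.ofReal 2 := by gcongr
      _ = ((128 : ℕ) : ℝ≥0∞) := by
          rw [show ENNReal.ofReal 2 = 2 by simp]
          norm_num
  · intro k l hkl
    refine le_trans ?_ (hN.abs_apply_le _ 0 0)
    simp only [Matrix.sub_apply, Matrix.diagonal_apply_eq, ha]
    rw [add_sub_add_left_eq_sub, ← sub_mul, abs_mul, abs_of_pos (by linarith : 0 < 3 * δ)]
    have h1 : (1 : ℝ) ≤ |(k.val : ℝ) - l.val| := by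
      have h2 : (1 : ℤ) ≤ |(k.val : ℤ) - l.val| := by
        apply Int.one_le_abs
        intro h
        exact hkl (Fin.ext (by omega))
      exact_mod_cast h2
    nlinarith

end MatrixNormal

namespace MatrixNormal

/-! ### The rates -/

variable {n d₁ d₂ : ℕ}

/-- If `δ² = c min (1, r / D)` with `c` below `10⁻⁷`, then the packing radius `384 δ` is small,
and the effective sample size `D` is small compared with `r / δ²`. -/
theorem radius_bounds {δ r D : ℝ} (hδ : 0 ≤ δ) (hr : 0 < r) (hD : 0 < D)
    (h : δ ^ 2 = 1 / 10 ^ 7 * min 1 (r / D)) :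
    0 < δ ∧ 384 * δ ≤ 1 / 5 ∧ (384 * δ) ^ 2 * D ≤ 1 / 50 * r := by
  have hmin : 0 < min 1 (r / D) := lt_min one_pos (div_pos hr hD)
  have hpos : 0 < δ := by
    rcases hδ.eq_or_lt with h0 | h0
    · rw [← h0] at h
      norm_num at h
      exact absurd h hmin.ne'
    · exact h0
  have h1 : δ ^ 2 ≤ 1 / 10 ^ 7 := by
    rw [h]; nlinarith [min_le_left 1 (r / D)]
  have h2 : δ ^ 2 * D ≤ 1 / 10 ^ 7 * r := by
    calc δ ^ 2 * D ≤ (1 / 10 ^ 7 * (r / D)) * D := by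
          rw [h]; gcongr; exact min_le_right _ _
      _ = 1 / 10 ^ 7 * r := by field_simp
  refine ⟨hpos, ?_, ?_⟩
  · refine le_of_sq_le_sq ?_ (by norm_num)
    rw [mul_pow]
    norm_num at h1 ⊢
    linarith
  · rw [mul_pow]
    norm_num at h2 ⊢
    nlinarith

theorem effective_columns (n d₁ d₂ : ℕ) :
    (min d₂ (n * d₁) = d₂ ∨ min d₂ (n * d₁) = n * d₁ ∧ min d₂ (n * d₁) ≤ d₂) ∧
      ((min d₂ (n * d₁) : ℕ) : ℝ) = min ((n : ℝ) * d₁) d₂ := by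
  refine ⟨?_, by rw [min_comm]; push_cast; rfl⟩
  rcases min_choice d₂ (n * d₁) with h | h
  · exact Or.inl h
  · exact Or.inr ⟨h, min_le_left _ _⟩

theorem half_le_iSup_relFrob (hn : 0 < n) (h₁ : 0 < d₁) (h₂ : 0 < d₂)
    {est : Samples n d₁ d₂ → Matrix (Fin d₁) (Fin d₁) ℝ} (hest : IsEstimator est)
    {S : Set (Matrix (Fin d₁) (Fin d₁) ℝ × Matrix (Fin d₂) (Fin d₂) ℝ)}
    (hS : S = params d₁ d₂ ∨ S = normalizedParams d₁ d₂) {δ : ℝ} (hδ : 0 ≤ δ)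
    (h : δ ^ 2 = 1 / 10 ^ 7 * min 1 ((d₁ : ℝ) ^ 2 / (n * min ((n : ℝ) * d₁) d₂))) :
    (1 / 2 : ℝ≥0∞) ≤ ⨆ θ ∈ S, law n θ.1 θ.2 {x | δ ≤ relFrob (est x) θ.1} := by
  obtain ⟨hm, hcast⟩ := effective_columns n d₁ d₂
  set m := min d₂ (n * d₁) with hmdef
  have hm0 : 0 < m := lt_min h₂ (Nat.mul_pos hn h₁)
  rw [← hcast] at h
  obtain ⟨hpos, h5, hrate⟩ := radius_bounds hδ (by positivity) (by positivity) h
  have hlog := Real.log_two_gt_d9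
  rcases Nat.lt_or_ge 1 d₁ with hd | hd
  · refine half_le_iSup_of_block (p := d₁ / 2) h₂ hm (by omega) (by omega) isIdealNorm_frobNorm
      norm_sub_le_frobNorm hpos h5 ?_ hest hS
    have hD : d₁ ^ 2 ≤ 5 * (d₁ / 2 * (d₁ - d₁ / 2)) := by
      rcases Nat.even_or_odd' d₁ with ⟨k, hk | hk⟩
      · have e1 : d₁ / 2 = k := by omega
        have e2 : d₁ - k = k := by omega
        rw [e1, e2, hk]; nlinarith
      · have e1 : d₁ / 2 = k := by omega
        have e2 : d₁ - k = k + 1 := by omega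
        have hk1 : 1 ≤ k := by omega
        rw [e1, e2, hk]; nlinarith
    have hD' : (d₁ : ℝ) ^ 2 ≤ 5 * ((d₁ / 2 * (d₁ - d₁ / 2) : ℕ) : ℝ) := by exact_mod_cast hD
    nlinarith
  · obtain rfl : d₁ = 1 := by omega
    refine half_le_iSup_of_scalar h₂ hm isIdealNorm_frobNorm hpos h5 ?_ hest hS
    norm_num at hrate hlog ⊢
    linarith

theorem half_le_iSup_relOp (hn : 0 < n) (h₁ : 0 < d₁) (h₂ : 0 < d₂)
    {est : Samples n d₁ d₂ → Matrix (Fin d₁) (Fin d₁) ℝ} (hest : IsEstimator est)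
    {S : Set (Matrix (Fin d₁) (Fin d₁) ℝ × Matrix (Fin d₂) (Fin d₂) ℝ)}
    (hS : S = params d₁ d₂ ∨ S = normalizedParams d₁ d₂) {δ : ℝ} (hδ : 0 ≤ δ)
    (h : δ ^ 2 = 1 / 10 ^ 7 * min 1 ((d₁ : ℝ) / (n * min ((n : ℝ) * d₁) d₂))) :
    (1 / 2 : ℝ≥0∞) ≤ ⨆ θ ∈ S, law n θ.1 θ.2 {x | δ ≤ relOp (est x) θ.1} := by
  obtain ⟨hm, hcast⟩ := effective_columns n d₁ d₂
  set m := min d₂ (n * d₁) with hmdef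
  have hm0 : 0 < m := lt_min h₂ (Nat.mul_pos hn h₁)
  rw [← hcast] at h
  obtain ⟨hpos, h5, hrate⟩ := radius_bounds hδ (by positivity) (by positivity) h
  have hlog := Real.log_two_gt_d9
  rcases Nat.lt_or_ge 1 d₁ with hd | hd
  · refine half_le_iSup_of_block (p := 1) h₂ hm one_pos hd isIdealNorm_opNorm
      (norm_sub_le_opNorm h₁) hpos h5 ?_ hest hS
    have hD : d₁ ≤ 2 * (1 * (d₁ - 1)) := by omega
    have hD' : (d₁ : ℝ) ≤ 2 * ((1 * (d₁ - 1) : ℕ) : ℝ) := by exact_mod_cast hD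
    nlinarith
  · obtain rfl : d₁ = 1 := by omega
    refine half_le_iSup_of_scalar h₂ hm isIdealNorm_opNorm hpos h5 ?_ hest hS
    norm_num at hrate hlog ⊢
    linarith

/-- Markov's inequality turns a bound in probability into a bound for the mean squared error. -/
theorem le_iSup_lintegral_sq {α κ : Type*} [MeasurableSpace α] {S : Set κ} {P : κ → Measure α}
    {f : κ → α → ℝ} (hf : ∀ θ, Measurable (f θ)) {r : ℝ} (hr : 0 ≤ r)
    (h : ∀ δ : ℝ, 0 ≤ δ → δ ^ 2 = r → (1 / 2 : ℝ≥0∞) ≤ ⨆ θ ∈ S, P θ {x | δ ≤ f θ x}) :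
    ENNReal.ofReal (1 / 2 * r) ≤ ⨆ θ ∈ S, ∫⁻ x, ENNReal.ofReal (f θ x ^ 2) ∂(P θ) := by
  obtain ⟨δ, hδ, rfl⟩ : ∃ δ : ℝ, 0 ≤ δ ∧ δ ^ 2 = r := ⟨√r, Real.sqrt_nonneg r, Real.sq_sqrt hr⟩
  calc ENNReal.ofReal (1 / 2 * δ ^ 2) = ENNReal.ofReal (δ ^ 2) * (1 / 2) := by
        rw [mul_comm, ENNReal.ofReal_mul (by positivity), ENNReal.ofReal_div_of_pos two_pos]
        simp
    _ ≤ ENNReal.ofReal (δ ^ 2) * ⨆ θ ∈ S, P θ {x | δ ≤ f θ x} :=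
        mul_le_mul' le_rfl (h δ hδ rfl)
    _ = ⨆ θ ∈ S, ENNReal.ofReal (δ ^ 2) * P θ {x | δ ≤ f θ x} := by
        simp_rw [ENNReal.mul_iSup]
    _ ≤ ⨆ θ ∈ S, ∫⁻ x, ENNReal.ofReal (f θ x ^ 2) ∂(P θ) := by
        refine iSup₂_mono fun θ _ => ?_
        refine le_trans ?_ (mul_meas_ge_le_lintegral₀
          (((hf θ).pow_const 2).ennreal_ofReal).aemeasurable (ENNReal.ofReal (δ ^ 2)))
        refine mul_le_mul' le_rfl (measure_mono fun x hx => ?_)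
        exact ENNReal.ofReal_le_ofReal (pow_le_pow_left₀ hδ hx 2)

end MatrixNormal

open MatrixNormal in
theorem theorem4 :
    (∃ c : ℝ, 0 < c ∧
      ∀ (n d₁ d₂ : ℕ), 0 < n → 0 < d₁ → 0 < d₂ →
      ∀ est : Samples n d₁ d₂ → Matrix (Fin d₁) (Fin d₁) ℝ, IsEstimator est →
      ∀ S, S = params d₁ d₂ ∨ S = normalizedParams d₁ d₂ →
        (∀ δ : ℝ, 0 ≤ δ →
          δ ^ 2 = c * min 1 ((d₁ : ℝ) ^ 2 / (n * min ((n : ℝ) * d₁) d₂)) →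
          (1 / 2 : ℝ≥0∞) ≤ ⨆ θ ∈ S, law n θ.1 θ.2 {x | δ ≤ relFrob (est x) θ.1}) ∧
        (∀ δ : ℝ, 0 ≤ δ →
          δ ^ 2 = c * min 1 ((d₁ : ℝ) / (n * min ((n : ℝ) * d₁) d₂)) →
          (1 / 2 : ℝ≥0∞) ≤ ⨆ θ ∈ S, law n θ.1 θ.2 {x | δ ≤ relOp (est x) θ.1})) ∧
    (∃ c : ℝ, 0 < c ∧
      ∀ (n d₁ d₂ : ℕ), 0 < n → 0 < d₁ → 0 < d₂ →
      ∀ est : Samples n d₁ d₂ → Matrix (Fin d₁) (Fin d₁) ℝ, IsEstimator est →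
      ∀ S, S = params d₁ d₂ ∨ S = normalizedParams d₁ d₂ →
        ENNReal.ofReal (c * min 1 ((d₁ : ℝ) ^ 2 / (n * min ((n : ℝ) * d₁) d₂))) ≤
          ⨆ θ ∈ S, ∫⁻ x, ENNReal.ofReal (relFrob (est x) θ.1 ^ 2) ∂(law n θ.1 θ.2) ∧
        ENNReal.ofReal (c * min 1 ((d₁ : ℝ) / (n * min ((n : ℝ) * d₁) d₂))) ≤
          ⨆ θ ∈ S, ∫⁻ x, ENNReal.ofReal (relOp (est x) θ.1 ^ 2) ∂(law n θ.1 θ.2)) := by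
  refine ⟨⟨1 / 10 ^ 7, by norm_num, ?_⟩, ⟨1 / 2 * (1 / 10 ^ 7), by norm_num, ?_⟩⟩
  · intro n d₁ d₂ hn h₁ h₂ est hest S hS
    exact ⟨fun δ hδ h => half_le_iSup_relFrob hn h₁ h₂ hest hS hδ h,
      fun δ hδ h => half_le_iSup_relOp hn h₁ h₂ hest hS hδ h⟩
  · intro n d₁ d₂ hn h₁ h₂ est hest S hS
    constructor
    · have hf : ∀ θ : Matrix (Fin d₁) (Fin d₁) ℝ × Matrix (Fin d₂) (Fin d₂) ℝ,
          Measurable fun x => relFrob (est x) θ.1 :=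
        fun θ => hest.measurable_relDiff isIdealNorm_frobNorm θ.1
      have h := le_iSup_lintegral_sq (S := S) (P := fun θ => law n θ.1 θ.2) hf
        (r := 1 / 10 ^ 7 * min 1 ((d₁ : ℝ) ^ 2 / (n * min ((n : ℝ) * d₁) d₂))) (by positivity)
      have h2 := h fun δ hδ h => half_le_iSup_relFrob hn h₁ h₂ hest hS hδ h
      rw [mul_assoc]
      exact h2
    · have hf : ∀ θ : Matrix (Fin d₁) (Fin d₁) ℝ × Matrix (Fin d₂) (Fin d₂) ℝ,
          Measurable fun x => relOp (est x) θ.1 :=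
        fun θ => hest.measurable_relDiff isIdealNorm_opNorm θ.1
      have h := le_iSup_lintegral_sq (S := S) (P := fun θ => law n θ.1 θ.2) hf
        (r := 1 / 10 ^ 7 * min 1 ((d₁ : ℝ) / (n * min ((n : ℝ) * d₁) d₂))) (by positivity)
      have h2 := h fun δ hδ h => half_le_iSup_relOp hn h₁ h₂ hest hS hδ h
      rw [mul_assoc]
      exact h2
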